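/- For $s\ge 0$ let $H^s(\mathbb R)=(1-\Delta)^{-s/2}L^2(\mathbb R;\mathbb C)$ with norm $\|f\|_{H^s}=\|(1-\Delta)^{s/2}f\|_{L^2}$, and let $(-\Delta)^{1/2}=\mathfrak F^{-1}|\xi|\mathfrak F$, where $\mathfrak F$ is the Fourier transform normalized so that $-\Delta=\mathfrak F^{-1}|\xi|^2\mathfrak F$. For $p>1$ consider the Cauchy problem $$ i\partial_t u-(-\Delta)^{1/2}u=-i|u|^{p-1}u,\qquad u(0)=u_0, \qquad x\in\mathbb R. \tag{1}$$ Let $s\ge 1$. For $T>0$, a solution of (1) on $[0,T]$ with $u_0\in H^s(\mathbb R)$ is a function $u\in C([0,T];H^s(\mathbb R))$ with $u(0)=u_0$ that is differentiable as an $L^2(\mathbb R)$-valued function on $[0,T]$ (one-sidedly at the end points) and satisfies the equation in $L^2(\mathbb R)$ at every $t\in[0,T]$. The problem (1) is called globally well-posed in $H^s(\mathbb R)$ if for every $T>0$ there is a Banach space $Y$, continuously embedded in $C([0,T];H^s(\mathbb R))$, such that * for every $u_0\in H^s(\mathbb R)$ there is exactly one solution $u\in Y$ of (1) on $[0,T]$;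 * if $u_0,u_{0,n}\in H^s(\mathbb R)$ and $\|u_{0,n}-u_0\|_{H^s}\to 0$ as $n\to\infty$, then the solutions $u,u_n\in Y$ with initial data $u_0,u_{0,n}$ satisfy $\|u_n-u\|_Y\to 0$. **Proposition.** For every $p>1$ the Cauchy problem (1) is globally well-posed in $H^1(\mathbb R)$. Moreover, for $p=3$ it is globally well-posed in $H^s(\mathbb R)$ for every $s$ with $1<s\le 2$. -/

import Mathlib

open MeasureTheory Filter Topology
open scoped FourierTransform

noncomputable section

namespace Semirelativistic

/-- The complex Hilbert space `L²(ℝ)`. -/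
abbrev L2 : Type := Lp ℂ 2 (volume : Measure ℝ)

/-- The symbol of `(1 - Δ)^{s/2}`. The Fourier transform of Mathlib has the kernel
`exp(-2πi x ξ)`, so that `-Δ` has the symbol `(2πξ)²`. -/
def besselSymbol (s ξ : ℝ) : ℝ := (1 + (2 * Real.pi * ξ) ^ 2) ^ (s / 2)

/-- For `s ≥ 0`, the elements of `H^s(ℝ) = (1 - Δ)^{-s/2} L²(ℝ)`, as a subspace of `L²(ℝ)`. -/
def sobolevSubmodule (s : ℝ) : Submodule ℂ L2 where
  carrier := {f | MemLp (fun ξ : ℝ => (besselSymbol s ξ : ℂ) * (𝓕 f : L2) ξ) 2 volume}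
  add_mem' {f g} hf hg := by
    refine (hf.add hg).ae_eq ?_
    have h : (𝓕 (f + g) : L2) = 𝓕 f + 𝓕 g := FourierTransform.fourier_add f g
    rw [h]
    filter_upwards [Lp.coeFn_add (𝓕 f : L2) (𝓕 g : L2)] with ξ hξ
    simp only [hξ, Pi.add_apply, mul_add]
  zero_mem' := by
    refine (MemLp.zero (ε := ℂ) (p := 2) (μ := (volume : Measure ℝ))).ae_eq ?_
    have h : (𝓕 (0 : L2) : L2) = 0 := (Lp.fourierTransformₗᵢ ℝ ℂ).map_zero
    rw [h]
    filter_upwards [Lp.coeFn_zero ℂ 2 (volume : Measure ℝ)] with ξ hξ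
    rw [hξ]
    simp
  smul_mem' c f hf := by
    refine (hf.const_smul c).ae_eq ?_
    have h : (𝓕 (c • f) : L2) = c • (𝓕 f : L2) := FourierTransform.fourier_smul c f
    rw [h]
    filter_upwards [Lp.coeFn_smul c (𝓕 f : L2)] with ξ hξ
    simp only [hξ, Pi.smul_apply, smul_eq_mul]
    ring

/-- The Sobolev space `H^s(ℝ)`, `s ≥ 0`. It is a type of its own because its norm is not that
of `L²(ℝ)`. -/
def Hs (s : ℝ) : Type := sobolevSubmodule s

instance (s : ℝ) : AddCommGroup (Hs s) := inferInstanceAs (AddCommGroup (sobolevSubmodule s))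

instance (s : ℝ) : Module ℂ (Hs s) := inferInstanceAs (Module ℂ (sobolevSubmodule s))

/-- The inclusion of `H^s(ℝ)` into `L²(ℝ)`. -/
def Hs.toL2 {s : ℝ} : Hs s →ₗ[ℂ] L2 := (sobolevSubmodule s).subtype

theorem Hs.memLp {s : ℝ} (f : Hs s) :
    MemLp (fun ξ : ℝ => (besselSymbol s ξ : ℂ) * (𝓕 f.toL2 : L2) ξ) 2 volume :=
  Subtype.property (p := fun g : L2 => g ∈ sobolevSubmodule s) f

/-- The Fourier transform of `(1 - Δ)^{s/2} f`, for `f ∈ H^s(ℝ)`. -/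
def Hs.weightedFourier (s : ℝ) : Hs s →ₗ[ℂ] L2 where
  toFun f := f.memLp.toLp
  map_add' f g := by
    rw [← MemLp.toLp_add f.memLp g.memLp, MemLp.toLp_eq_toLp_iff]
    have h : (𝓕 (f + g).toL2 : L2) = 𝓕 f.toL2 + 𝓕 g.toL2 := by
      rw [map_add]; exact FourierTransform.fourier_add _ _
    rw [h]
    filter_upwards [Lp.coeFn_add (𝓕 f.toL2 : L2) (𝓕 g.toL2 : L2)] with ξ hξ
    simp only [hξ, Pi.add_apply, mul_add]
  map_smul' c f := by
    rw [RingHom.id_apply, ← MemLp.toLp_const_smul c f.memLp, MemLp.toLp_eq_toLp_iff]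
    have h : (𝓕 (c • f).toL2 : L2) = c • (𝓕 f.toL2 : L2) := by
      rw [map_smul]; exact FourierTransform.fourier_smul _ _
    rw [h]
    filter_upwards [Lp.coeFn_smul c (𝓕 f.toL2 : L2)] with ξ hξ
    simp only [hξ, Pi.smul_apply, smul_eq_mul]
    ring

theorem Hs.weightedFourier_injective (s : ℝ) : Function.Injective (Hs.weightedFourier s) := by
  rw [injective_iff_map_eq_zero]
  intro f hf
  have h0 : (𝓕 f.toL2 : L2) = 0 := by
    apply Lp.ext
    have h1 := MemLp.coeFn_toLp f.memLp
    have h2 : (Hs.weightedFourier s f : L2) =ᵐ[volume] (0 : L2) := by rw [hf]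
    filter_upwards [h1, h2, Lp.coeFn_zero ℂ 2 (volume : Measure ℝ)] with ξ a b c
    have d : (besselSymbol s ξ : ℂ) * (𝓕 f.toL2 : L2) ξ = 0 := by
      rw [c] at b
      exact a.symm.trans b
    have e : (besselSymbol s ξ : ℂ) ≠ 0 := by
      have : 0 < besselSymbol s ξ := by unfold besselSymbol; positivity
      exact_mod_cast this.ne'
    rw [c]
    simpa [e] using d
  have h3 : f.toL2 = 0 := (Lp.fourierTransformₗᵢ ℝ ℂ).map_eq_zero_iff.1 h0
  exact Subtype.ext h3

/-- The norm `‖f‖_{H^s} = ‖(1 - Δ)^{s/2} f‖_{L²}`, written on the Fourier side. -/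
instance (s : ℝ) : NormedAddCommGroup (Hs s) :=
  NormedAddCommGroup.induced (Hs s) L2 (Hs.weightedFourier s) (Hs.weightedFourier_injective s)

instance (s : ℝ) : NormedSpace ℂ (Hs s) := NormedSpace.induced ℂ (Hs s) L2 (Hs.weightedFourier s)

/-- `g = (-Δ)^{1/2} f` in `L²(ℝ)`: the graph of the operator with the Fourier symbol `|2πξ|`. -/
def IsHalfLaplacian (f g : L2) : Prop :=
  ∀ᵐ ξ : ℝ, (𝓕 g : L2) ξ = ((|2 * Real.pi * ξ| : ℝ) : ℂ) * (𝓕 f : L2) ξ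

/-- `u ∈ C([0,T]; H^s)` solves `i ∂ₜu - (-Δ)^{1/2} u = -i |u|^{p-1} u`, `u(0) = u₀` on `[0,T]`:
the time derivative is that of `u` as a function with values in `L²(ℝ)` (one-sided at the end
points), and the equation holds at every time, almost everywhere in space. -/
structure IsSolution (p : ℝ) {s T : ℝ} (hT : 0 ≤ T) (u₀ : Hs s)
    (u : C(Set.Icc 0 T, Hs s)) : Prop where
  initial : u ⟨0, Set.left_mem_Icc.2 hT⟩ = u₀
  equation : ∀ t : Set.Icc 0 T, ∃ ut Du : L2,
    HasDerivWithinAt (fun τ : ℝ => (Set.IccExtend hT u τ).toL2) ut (Set.Icc 0 T) t ∧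
    IsHalfLaplacian (u t).toL2 Du ∧
    ∀ᵐ x : ℝ, Complex.I * ut x - Du x =
      -Complex.I * ((‖(u t).toL2 x‖ ^ (p - 1) : ℝ) : ℂ) * (u t).toL2 x

/-- Well-posedness in `H^s(ℝ)` on the time interval `[0,T]`: there is a Banach space
`Y ↪ C([0,T]; H^s)` such that every initial datum in `H^s` has exactly one solution in `Y`, and
the solutions depend continuously, in the norm of `Y`, on the data. -/
def WellPosedOn (p s : ℝ) {T : ℝ} (hT : 0 ≤ T) : Prop :=
  ∃ (Y : Type) (_ : NormedAddCommGroup Y) (_ : NormedSpace ℂ Y) (_ : CompleteSpace Y)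
    (j : Y →L[ℂ] C(Set.Icc 0 T, Hs s)),
    Function.Injective j ∧
    (∀ u₀ : Hs s, ∃! u : Y, IsSolution p hT u₀ (j u)) ∧
    ∀ (u₀ : Hs s) (u : Y) (v₀ : ℕ → Hs s) (v : ℕ → Y),
      IsSolution p hT u₀ (j u) → (∀ n, IsSolution p hT (v₀ n) (j (v n))) →
      Tendsto (fun n => ‖v₀ n - u₀‖) atTop (𝓝 0) → Tendsto (fun n => ‖v n - u‖) atTop (𝓝 0)

/-- Global well-posedness in `H^s(ℝ)`: well-posedness on `[0,T]` for every `T > 0`. -/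
def GloballyWellPosed (p s : ℝ) : Prop :=
  ∀ (T : ℝ) (hT : 0 < T), WellPosedOn p s hT.le

end Semirelativistic

end

open MeasureTheory Filter Topology
open scoped FourierTransform

noncomputable section

namespace Semirelativistic

/-! Write the equation as `∂ₜu = -i(-Δ)^{1/2}u - N(u)` with `N(z) = |z|^{p-1}z`. In the interaction
picture `w(t) = exp(it(-Δ)^{1/2})u(t)` the unbounded operator disappears, and `w` solves an ordinary
differential equation whose field is `N` conjugated by isometries of `L²`. The map `N` is monotone:
it is radial with nondecreasing profile. Hence the `L²` distance of two solutions never increases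
(`IsInteractionCurve.norm_sub_le`). This gives uniqueness. Since the equation commutes with
translations, a solution can also be compared with its own translates, so the bound `‖u(·+h) - u‖ ≤
R|h|` is preserved. In `L²` this bound characterises `H¹`, so the `H¹` a priori bound needs no
derivative of `N`.

For existence in `H¹`, `N` is cut off outside a disc. This keeps it monotone and makes it globally
Lipschitz on `L²`, so Picard–Lindelöf applies there. The translation bound together with the
embedding of `H¹` into bounded functions shows that a cut-off at `cutHeight ‖u₀‖` is never active.
Continuous dependence in `H¹` applies Gronwall to the translation increments of the difference of
two solutions. The error term involves the modulus of continuity of the derivative of `N` (for `p`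
near 1 only continuity is available), and it is small because two solutions close in `L²` and
bounded in `H¹` are uniformly close.

For `p = 3` the equation is solved as an ordinary differential equation in `H^s` itself, which is an
algebra with a tame product estimate (`Hs.exists_mul`). In that estimate the cubic term is linear in
the `H^s` norm, with coefficients given by the `L¹` norm of the Fourier transform, and the `H¹`
theory bounds these coefficients. Gronwall then excludes blow-up, and the field is locally
Lipschitz, so the dependence on the data is too. -/

/-! ### Radial retractions and ordinary differential equations in Banach spaces -/

section ODE

variable {X : Type*} [NormedAddCommGroup X]

/-- The factor by which the radial retraction onto the ball of radius `R` shrinks `x`. -/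
def radialFactor (R : ℝ) (x : X) : ℝ := min 1 (R / ‖x‖)

theorem radialFactor_le_one (R : ℝ) (x : X) : radialFactor R x ≤ 1 := min_le_left _ _

theorem radialFactor_nonneg {R : ℝ} (hR : 0 ≤ R) (x : X) : 0 ≤ radialFactor R x :=
  le_min zero_le_one (by positivity)

variable [NormedSpace ℝ X]

/-- The radial retraction onto the closed ball of radius `R`. -/
def radialRetraction (R : ℝ) (x : X) : X := radialFactor R x • x

theorem radialRetraction_of_norm_le {R : ℝ} {x : X} (h : ‖x‖ ≤ R) :
    radialRetraction R x = x := by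
  rcases eq_or_ne x 0 with rfl | hx
  · simp [radialRetraction]
  · have : 1 ≤ R / ‖x‖ := (one_le_div (norm_pos_iff.2 hx)).2 h
    simp [radialRetraction, radialFactor, this]

theorem norm_radialRetraction {R : ℝ} (hR : 0 ≤ R) (x : X) :
    ‖radialRetraction R x‖ = min ‖x‖ R := by
  rcases eq_or_ne x 0 with rfl | hx
  · simp [radialRetraction, hR]
  · have hx' : 0 < ‖x‖ := norm_pos_iff.2 hx
    rw [radialRetraction, norm_smul, Real.norm_of_nonneg (radialFactor_nonneg hR x), radialFactor,
      min_mul_of_nonneg _ _ hx'.le, one_mul, div_mul_cancel₀ _ hx'.ne']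

theorem norm_radialRetraction_le {R : ℝ} (hR : 0 ≤ R) (x : X) : ‖radialRetraction R x‖ ≤ R :=
  (norm_radialRetraction hR x).trans_le (min_le_right _ _)

theorem norm_radialRetraction_le_norm {R : ℝ} (hR : 0 ≤ R) (x : X) :
    ‖radialRetraction R x‖ ≤ ‖x‖ :=
  (norm_radialRetraction hR x).trans_le (min_le_left _ _)

/-- With `‖y‖ ≤ ‖x‖`, the difference of the images is the shrunken `x - y` plus the change of factor
applied to `y`, and each part is at most `‖x - y‖`. The argument uses no inner product, hence the
constant 2. -/
theorem lipschitzWith_radialRetraction {R : ℝ} (hR : 0 ≤ R) :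
    LipschitzWith 2 (radialRetraction R : X → X) := by
  refine LipschitzWith.of_dist_le_mul fun x y => ?_
  wlog h : ‖y‖ ≤ ‖x‖ generalizing x y
  · rw [dist_comm, dist_comm x y]
    exact this y x (le_of_not_ge h)
  rw [dist_eq_norm, dist_eq_norm, NNReal.coe_ofNat]
  rcases le_or_gt ‖x‖ R with hx | hx
  · rw [radialRetraction_of_norm_le hx, radialRetraction_of_norm_le (h.trans hx)]
    linarith [norm_nonneg (x - y)]
  have hx0 : 0 < ‖x‖ := hR.trans_lt hx
  have hθ : radialFactor R x = R / ‖x‖ := min_eq_right ((div_le_one hx0).2 hx.le)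
  have hle : radialFactor R x ≤ 1 := radialFactor_le_one R x
  have hnn := radialFactor_nonneg hR x
  -- Writing `θ` for the factor: `(θ_y - θ_x)‖y‖ ≤ R - θ_x‖y‖ = θ_x(‖x‖ - ‖y‖)`.
  have key : ‖(radialFactor R x - radialFactor R y) • y‖ ≤ ‖x - y‖ := by
    rcases eq_or_ne y 0 with rfl | hy
    · simp
    have hy0 : 0 < ‖y‖ := norm_pos_iff.2 hy
    have hxy : radialFactor R x ≤ radialFactor R y :=
      min_le_min_left _ (div_le_div_of_nonneg_left hR hy0 h)
    have h1 : radialFactor R y * ‖y‖ ≤ R := by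
      have := norm_radialRetraction_le hR y
      rwa [radialRetraction, norm_smul, Real.norm_of_nonneg (radialFactor_nonneg hR y)] at this
    have h2 : R = radialFactor R x * ‖x‖ := by rw [hθ, div_mul_cancel₀ _ hx0.ne']
    have h3 : ‖x‖ - ‖y‖ ≤ ‖x - y‖ := norm_sub_norm_le x y
    rw [norm_smul, Real.norm_eq_abs, abs_sub_comm, abs_of_nonneg (sub_nonneg.2 hxy)]
    nlinarith
  calc ‖radialRetraction R x - radialRetraction R y‖
      = ‖radialFactor R x • (x - y) + (radialFactor R x - radialFactor R y) • y‖ := by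
        congr 1
        simp only [radialRetraction, smul_sub, sub_smul]
        abel
    _ ≤ 1 * ‖x - y‖ + ‖x - y‖ := by
        refine (norm_add_le _ _).trans (add_le_add ?_ key)
        rw [norm_smul, Real.norm_of_nonneg hnn]
        gcongr
    _ = 2 * ‖x - y‖ := by ring

/-- A vector field that is Lipschitz on the ball of radius `R`, truncated by the radial
retraction, has integral curves on all of `[0, T]`. -/
theorem exists_truncated_integralCurve [CompleteSpace X] {T R : ℝ} (hT : 0 ≤ T) (hR : 0 ≤ R)
    (f : ℝ → X → X) {K : NNReal}
    (hlip : ∀ t, ∀ x y : X, ‖x‖ ≤ R → ‖y‖ ≤ R → ‖f t x - f t y‖ ≤ K * ‖x - y‖)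
    (hcont : ∀ x, Continuous fun t => f t x) (hzero : ∀ t, f t 0 = 0) (x₀ : X) :
    ∃ w : ℝ → X, w 0 = x₀ ∧ ∀ t ∈ Set.Icc 0 T,
      HasDerivWithinAt w (f t (radialRetraction R (w t))) (Set.Icc 0 T) t := by
  -- After truncation the field is bounded by `K R` everywhere, so the ball of radius `K R T` about
  -- `x₀` cannot be left before time `T`. No smallness of `T` is needed.
  have hpl : IsPicardLindelof (fun t x => f t (radialRetraction R x))
      (⟨0, Set.left_mem_Icc.2 hT⟩ : Set.Icc (0 : ℝ) T) x₀
      (K * R.toNNReal * T.toNNReal) 0 (K * R.toNNReal) (K * 2) := by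
    refine ⟨fun t _ => ?_, fun x _ => (hcont _).continuousOn, fun t _ x _ => ?_, ?_⟩
    · refine (LipschitzWith.of_dist_le_mul fun x y => ?_).lipschitzOnWith
      rw [dist_eq_norm]
      refine (hlip t _ _ (norm_radialRetraction_le hR x) (norm_radialRetraction_le hR y)).trans ?_
      have := (lipschitzWith_radialRetraction hR).dist_le_mul x y
      rw [dist_eq_norm] at this
      rw [NNReal.coe_mul, mul_assoc]
      gcongr
    · have := hlip t (radialRetraction R x) 0 (norm_radialRetraction_le hR x) (by simpa using hR)
      rw [hzero, sub_zero, sub_zero] at this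
      refine this.trans ?_
      rw [NNReal.coe_mul, Real.coe_toNNReal R hR]
      gcongr
      exact norm_radialRetraction_le hR x
    · simp [hT, hR]
  exact hpl.exists_eq_forall_mem_Icc_hasDerivWithinAt₀

theorem norm_sub_le_of_norm_deriv_le_Icc {T C : ℝ} {w w' : ℝ → X}
    (hw : ∀ t ∈ Set.Icc 0 T, HasDerivWithinAt w (w' t) (Set.Icc 0 T) t)
    (hC : ∀ t ∈ Set.Icc 0 T, ‖w' t‖ ≤ C) {t t' : ℝ} (ht : t ∈ Set.Icc 0 T)
    (ht' : t' ∈ Set.Icc 0 T) : ‖w t' - w t‖ ≤ C * ‖t' - t‖ :=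
  (convex_Icc 0 T).norm_image_sub_le_of_norm_hasDerivWithin_le hw hC ht ht'

/-- Gronwall with the forcing term coarsened through `(exp(KT) - 1)/K ≤ T exp(KT)`, which gives one
bound on all of `[0, T]` that also covers `K = 0`. -/
theorem norm_le_mul_exp_of_norm_deriv_le {T K ε δ : ℝ} (hK : 0 ≤ K) (hε : 0 ≤ ε)
    (hδ : 0 ≤ δ) {w w' : ℝ → X}
    (hw : ∀ t ∈ Set.Icc 0 T, HasDerivWithinAt w (w' t) (Set.Icc 0 T) t) (h0 : ‖w 0‖ ≤ δ)
    (hC : ∀ t ∈ Set.Icc 0 T, ‖w' t‖ ≤ K * ‖w t‖ + ε) {t : ℝ} (ht : t ∈ Set.Icc 0 T) :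
    ‖w t‖ ≤ (δ + ε * T) * Real.exp (K * T) := by
  have hT : 0 ≤ T := ht.1.trans ht.2
  have hg := norm_le_gronwallBound_of_norm_deriv_right_le (f := w) (f' := w') (δ := δ) (K := K)
    (ε := ε) (a := 0) (b := T) (fun t ht => (hw t ht).continuousWithinAt)
    (fun t ht => (hw t ⟨ht.1, ht.2.le⟩).mono_of_mem_nhdsWithin (Icc_mem_nhdsGE_of_mem ht))
    h0 (fun t ht => hC t ⟨ht.1, ht.2.le⟩) t ht
  rw [sub_zero] at hg
  have hexp : 1 ≤ Real.exp (K * T) := Real.one_le_exp (by positivity)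
  refine hg.trans ((gronwallBound_mono hδ hε hK ht.2).trans ?_)
  rcases hK.eq_or_lt with rfl | hK'
  · simp [gronwallBound_K0]
  rw [gronwallBound_of_K_ne_0 hK'.ne', add_mul]
  refine add_le_add le_rfl ?_
  rw [mul_assoc, div_mul_eq_mul_div, mul_div_assoc]
  refine mul_le_mul_of_nonneg_left ?_ hε
  rw [div_le_iff₀ hK']
  have h1 := Real.add_one_le_exp (-(K * T))
  have h2 : Real.exp (-(K * T)) * Real.exp (K * T) = 1 := by rw [← Real.exp_add]; simp
  have h3 := Real.exp_pos (K * T)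
  nlinarith

end ODE

/-- Two curves in a Hilbert space whose difference is dissipated do not move apart. -/
theorem norm_sub_le_of_dissipative {H : Type*} [NormedAddCommGroup H] [InnerProductSpace ℝ H]
    {T : ℝ} {w w' z z' : ℝ → H}
    (hw : ∀ t ∈ Set.Icc 0 T, HasDerivWithinAt w (w' t) (Set.Icc 0 T) t)
    (hz : ∀ t ∈ Set.Icc 0 T, HasDerivWithinAt z (z' t) (Set.Icc 0 T) t)
    (h : ∀ t ∈ Set.Icc 0 T, inner ℝ (w t - z t) (w' t - z' t) ≤ 0) {t : ℝ}
    (ht : t ∈ Set.Icc 0 T) : ‖w t - z t‖ ≤ ‖w 0 - z 0‖ := by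
  have hd : ∀ t ∈ Set.Icc 0 T, HasDerivWithinAt (fun t => ‖w t - z t‖ ^ 2)
      (2 * inner ℝ (w t - z t) (w' t - z' t)) (Set.Icc 0 T) t :=
    fun t ht => ((hw t ht).sub (hz t ht)).norm_sq
  have hanti : AntitoneOn (fun t => ‖w t - z t‖ ^ 2) (Set.Icc 0 T) := by
    refine antitoneOn_of_hasDerivWithinAt_nonpos (convex_Icc 0 T)
      (fun t ht => (hd t ht).continuousWithinAt)
      (fun t ht => (hd t (interior_subset ht)).mono interior_subset) fun t ht => ?_
    have := h t (interior_subset ht)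
    linarith
  have := hanti (Set.left_mem_Icc.2 (ht.1.trans ht.2)) ht ht.1
  exact pow_le_pow_iff_left₀ (norm_nonneg _) (norm_nonneg _) two_ne_zero |>.1 this

/-! ### Phase multipliers on `L²` -/

theorem L2_norm_sq (f : L2) : ‖f‖ ^ 2 = ∫ x, ‖f x‖ ^ 2 := by
  rw [← real_inner_self_eq_norm_sq, L2.inner_def]
  simp

theorem L2_integrable_norm_sq (f : L2) : Integrable (fun x => ‖f x‖ ^ 2) :=
  (memLp_two_iff_integrable_sq_norm (Lp.aestronglyMeasurable f)).1 (Lp.memLp f)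

/-- The multipliers are complex linear, while derivatives in time and the dissipation inequality are
real; this reconciles the two scalar actions. -/
theorem L2_coe_smul (c : ℝ) (f : L2) : (c : ℂ) • f = c • f := by
  apply Lp.ext
  filter_upwards [Lp.coeFn_smul (c : ℂ) f, Lp.coeFn_smul c f] with x h1 h2
  rw [h1, h2]
  simp

/-- Multiplication by a bounded family of functions that tends to zero pointwise. -/
theorem tendsto_norm_zero_of_multipliers {ι : Type*} {l : Filter ι} [l.IsCountablyGenerated]
    (m : ι → ℝ → ℂ) (C : ℝ) (hC : ∀ k ξ, ‖m k ξ‖ ≤ C)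
    (hlim : ∀ ξ, Tendsto (fun k => m k ξ) l (𝓝 0)) (g : L2) (G : ι → L2)
    (hG : ∀ k, ∀ᵐ ξ, G k ξ = m k ξ * g ξ) : Tendsto (fun k => ‖G k‖) l (𝓝 0) := by
  have hae : ∀ k, (fun ξ => ‖G k ξ‖ ^ 2) =ᵐ[volume] fun ξ => ‖m k ξ * g ξ‖ ^ 2 := fun k => by
    filter_upwards [hG k] with ξ hξ
    rw [hξ]
  have hsq : Tendsto (fun k => ‖G k‖ ^ 2) l (𝓝 0) := by
    have h0 : (0 : ℝ) = ∫ _ : ℝ, (0 : ℝ) := by simp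
    simp_rw [L2_norm_sq, integral_congr_ae (hae _)]
    rw [h0]
    refine tendsto_integral_filter_of_dominated_convergence (fun ξ => C ^ 2 * ‖g ξ‖ ^ 2)
      (Eventually.of_forall fun k => (L2_integrable_norm_sq (G k)).1.congr (hae k))
      (Eventually.of_forall fun k => ?_) ((L2_integrable_norm_sq g).const_mul _) ?_
    · refine Eventually.of_forall fun ξ => ?_
      rw [norm_mul, mul_pow, Real.norm_of_nonneg (by positivity)]
      gcongr
      exact hC k ξ
    · refine Eventually.of_forall fun ξ => ?_
      simpa using ((hlim ξ).mul_const (g ξ)).norm.pow 2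
  have := hsq.sqrt
  simpa [Real.sqrt_sq (norm_nonneg _)] using this

/-- The unimodular factor `exp(i t ω(ξ))`. -/
def phase (ω : C(ℝ, ℝ)) (t ξ : ℝ) : ℂ := Complex.exp ((t * ω ξ : ℝ) * Complex.I)

@[simp]
theorem norm_phase (ω : C(ℝ, ℝ)) (t ξ : ℝ) : ‖phase ω t ξ‖ = 1 := Complex.norm_exp_ofReal_mul_I _

theorem continuous_phase (ω : C(ℝ, ℝ)) (t : ℝ) : Continuous (phase ω t) := by
  unfold phase
  fun_prop

theorem phase_add (ω : C(ℝ, ℝ)) (t t' ξ : ℝ) :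
    phase ω (t + t') ξ = phase ω t ξ * phase ω t' ξ := by
  rw [phase, phase, phase, ← Complex.exp_add]
  push_cast
  ring_nf

@[simp]
theorem phase_zero (ω : C(ℝ, ℝ)) (ξ : ℝ) : phase ω 0 ξ = 1 := by simp [phase]

theorem memLp_phase_mul (ω : C(ℝ, ℝ)) (t : ℝ) (g : L2) :
    MemLp (fun ξ => phase ω t ξ * g ξ) 2 volume :=
  (Lp.memLp g).of_le ((continuous_phase ω t).aestronglyMeasurable.mul (Lp.aestronglyMeasurable g))
    (Eventually.of_forall fun ξ => by simp)

/-- Multiplication by `exp(i t ω)` on `L²`. -/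
def phaseMul (ω : C(ℝ, ℝ)) (t : ℝ) : L2 →ₗᵢ[ℂ] L2 where
  toFun g := (memLp_phase_mul ω t g).toLp
  map_add' f g := by
    rw [← MemLp.toLp_add, MemLp.toLp_eq_toLp_iff]
    filter_upwards [Lp.coeFn_add f g] with ξ hξ
    simp only [hξ, Pi.add_apply, mul_add]
  map_smul' c f := by
    rw [RingHom.id_apply, ← MemLp.toLp_const_smul, MemLp.toLp_eq_toLp_iff]
    filter_upwards [Lp.coeFn_smul c f] with ξ hξ
    simp only [hξ, Pi.smul_apply, smul_eq_mul]
    ring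
  norm_map' g := by
    change ‖(memLp_phase_mul ω t g).toLp‖ = ‖g‖
    rw [Lp.norm_toLp, Lp.norm_def]
    congr 1
    exact eLpNorm_congr_norm_ae (Eventually.of_forall fun ξ => by simp)

theorem coeFn_phaseMul (ω : C(ℝ, ℝ)) (t : ℝ) (g : L2) :
    phaseMul ω t g =ᵐ[volume] fun ξ => phase ω t ξ * g ξ :=
  MemLp.coeFn_toLp (memLp_phase_mul ω t g)

theorem phaseMul_comm (ω ω' : C(ℝ, ℝ)) (t t' : ℝ) (g : L2) :
    phaseMul ω t (phaseMul ω' t' g) = phaseMul ω' t' (phaseMul ω t g) := by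
  apply Lp.ext
  filter_upwards [coeFn_phaseMul ω t (phaseMul ω' t' g), coeFn_phaseMul ω' t' g,
    coeFn_phaseMul ω' t' (phaseMul ω t g), coeFn_phaseMul ω t g] with ξ h1 h2 h3 h4
  rw [h1, h2, h3, h4]
  ring

theorem phaseMul_add (ω : C(ℝ, ℝ)) (t t' : ℝ) (g : L2) :
    phaseMul ω (t + t') g = phaseMul ω t (phaseMul ω t' g) := by
  apply Lp.ext
  filter_upwards [coeFn_phaseMul ω t (phaseMul ω t' g), coeFn_phaseMul ω t' g,
    coeFn_phaseMul ω (t + t') g] with ξ h1 h2 h3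
  rw [h1, h2, h3, phase_add, mul_assoc]

@[simp]
theorem phaseMul_zero (ω : C(ℝ, ℝ)) (g : L2) : phaseMul ω 0 g = g := by
  apply Lp.ext
  filter_upwards [coeFn_phaseMul ω 0 g] with ξ h1
  rw [h1, phase_zero, one_mul]

theorem tendsto_phase (ω : C(ℝ, ℝ)) (ξ : ℝ) : Tendsto (fun t => phase ω t ξ) (𝓝 0) (𝓝 1) := by
  have : Continuous fun t => phase ω t ξ := by unfold phase; fun_prop
  simpa using this.tendsto 0

/-- Dominated convergence gives continuity at time 0, and the group law carries it to every time. -/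
theorem continuous_phaseMul (ω : C(ℝ, ℝ)) (g : L2) : Continuous fun t => phaseMul ω t g := by
  have h0 : Tendsto (fun k => ‖phaseMul ω k g - g‖) (𝓝 0) (𝓝 0) := by
    refine tendsto_norm_zero_of_multipliers (fun k ξ => phase ω k ξ - 1) 2
      (fun k ξ => (norm_sub_le _ _).trans (by norm_num)) (fun ξ => ?_) g _ fun k => ?_
    · simpa using (tendsto_phase ω ξ).sub_const 1
    · filter_upwards [Lp.coeFn_sub (phaseMul ω k g) g, coeFn_phaseMul ω k g] with ξ h1 h2
      rw [h1, Pi.sub_apply, h2]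
      ring
  rw [continuous_iff_continuousAt]
  intro t
  rw [ContinuousAt, tendsto_iff_norm_sub_tendsto_zero]
  have h1 : Tendsto (fun t' => t' - t) (𝓝 t) (𝓝 0) := by
    simpa using (continuous_sub_right t).tendsto t
  refine (h0.comp h1).congr fun t' => ?_
  have : phaseMul ω t' g = phaseMul ω t (phaseMul ω (t' - t) g) := by
    rw [← phaseMul_add]
    ring_nf
  rw [Function.comp_apply, this, ← map_sub, LinearIsometry.norm_map]

theorem phaseMul_neg_cancel (ω : C(ℝ, ℝ)) (t : ℝ) (g : L2) :
    phaseMul ω (-t) (phaseMul ω t g) = g := by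
  rw [← phaseMul_add]
  simp

/-- The function `(exp(i x) - 1 - i x) / x`, which is bounded and tends to zero at the origin. -/
def expRemainder (x : ℝ) : ℂ := (Complex.exp (x * Complex.I) - 1 - x * Complex.I) / x

theorem norm_expRemainder_le (x : ℝ) : ‖expRemainder x‖ ≤ 2 := by
  rcases eq_or_ne x 0 with rfl | hx
  · simp [expRemainder]
  have h1 : ‖Complex.exp (x * Complex.I) - 1‖ ≤ ‖x‖ := by
    have := Real.norm_exp_I_mul_ofReal_sub_one_le (x := x)
    rwa [mul_comm] at this
  rw [expRemainder, norm_div, Complex.norm_real, div_le_iff₀ (norm_pos_iff.2 hx)]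
  refine (norm_sub_le _ _).trans ?_
  rw [norm_mul, Complex.norm_I, Complex.norm_real]
  linarith

theorem tendsto_expRemainder : Tendsto expRemainder (𝓝 0) (𝓝 0) := by
  have h : HasDerivAt (fun x : ℝ => Complex.exp (x * Complex.I)) Complex.I 0 := by
    have h1 : HasDerivAt (fun x : ℝ => (x : ℂ) * Complex.I) Complex.I 0 := by
      simpa using (Complex.ofRealCLM.hasDerivAt (x := (0 : ℝ))).mul_const Complex.I
    simpa using h1.cexp
  have h2 := h.tendsto_slope_zero
  have h3 : Tendsto expRemainder (𝓝[≠] 0) (𝓝 0) := by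
    have h4 := h2.sub_const Complex.I
    rw [sub_self] at h4
    refine h4.congr' ?_
    filter_upwards [self_mem_nhdsWithin] with x hx
    have hx' : (x : ℂ) ≠ 0 := by exact_mod_cast hx
    simp only [expRemainder, zero_add, Complex.ofReal_zero, zero_mul, Complex.exp_zero,
      Complex.real_smul, Complex.ofReal_inv]
    field_simp
  -- At the origin itself the remainder is 0 by the convention for division by zero, so the
  -- punctured limit is a full one.
  rw [← nhdsNE_sup_pure, tendsto_sup]
  exact ⟨h3, by rw [tendsto_pure_left]; intro s hs; simpa [expRemainder] using mem_of_mem_nhds hs⟩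

/-- The error of the difference quotient with step `k` is `expRemainder (k ω)` times `Dg`: a factor
`ω` has been absorbed into `Dg`, and the remaining multiplier is bounded by 2 and tends to 0
pointwise. So `Dg ∈ L²` alone provides the domination. -/
theorem hasDerivAt_phaseMul (ω : C(ℝ, ℝ)) (g Dg : L2) (h : ∀ᵐ ξ, Dg ξ = (ω ξ : ℂ) * g ξ) (t : ℝ) :
    HasDerivAt (fun τ => phaseMul ω τ g) (phaseMul ω t (Complex.I • Dg)) t := by
  have h0 : Tendsto (fun k : ℝ => ‖(k : ℂ)⁻¹ • (phaseMul ω k g - g - (k * Complex.I : ℂ) • Dg)‖)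
      (𝓝 0) (𝓝 0) := by
    refine tendsto_norm_zero_of_multipliers (fun k ξ => expRemainder (k * ω ξ)) 2
      (fun k ξ => norm_expRemainder_le _) (fun ξ => ?_) Dg _ fun k => ?_
    · refine tendsto_expRemainder.comp ?_
      simpa using (continuous_mul_const (ω ξ)).tendsto 0
    · filter_upwards [Lp.coeFn_smul (k : ℂ)⁻¹ (phaseMul ω k g - g - (k * Complex.I : ℂ) • Dg),
        Lp.coeFn_sub (phaseMul ω k g - g) ((k * Complex.I : ℂ) • Dg),
        Lp.coeFn_sub (phaseMul ω k g) g, Lp.coeFn_smul (k * Complex.I : ℂ) Dg,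
        coeFn_phaseMul ω k g, h] with ξ h1 h2 h3 h4 h5 h6
      rw [h1, Pi.smul_apply, h2, Pi.sub_apply, h3, Pi.sub_apply, h4, Pi.smul_apply, h5, h6]
      rcases eq_or_ne (ω ξ) 0 with h7 | h7
      · simp [h7, phase]
      rcases eq_or_ne k 0 with h8 | h8
      · simp [h8, expRemainder]
      have h7' : (ω ξ : ℂ) ≠ 0 := by exact_mod_cast h7
      have h8' : (k : ℂ) ≠ 0 := by exact_mod_cast h8
      simp only [smul_eq_mul, expRemainder, phase]
      push_cast
      field_simp
  rw [hasDerivAt_iff_tendsto]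
  have h1 : Tendsto (fun t' => t' - t) (𝓝 t) (𝓝 0) := by
    simpa using (continuous_sub_right t).tendsto t
  refine (h0.comp h1).congr fun t' => ?_
  have h2 : phaseMul ω t' g = phaseMul ω t (phaseMul ω (t' - t) g) := by
    rw [← phaseMul_add]
    ring_nf
  have h3 : (t' - t) • phaseMul ω t (Complex.I • Dg) =
      phaseMul ω t (((t' - t : ℝ) * Complex.I : ℂ) • Dg) := by
    rw [mul_smul, map_smul _ ((t' - t : ℝ) : ℂ), L2_coe_smul]
  simp only [Function.comp_apply]
  rw [h2, h3, ← map_sub, ← map_sub, LinearIsometry.norm_map, norm_smul, norm_inv,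
    Complex.norm_real]

/-- The Fourier multiplier `exp(i t ω(ξ))` on `L²`. -/
def phaseFlow (ω : C(ℝ, ℝ)) (t : ℝ) : L2 →ₗᵢ[ℂ] L2 :=
  (Lp.fourierTransformₗᵢ ℝ ℂ).symm.toLinearIsometry.comp
    ((phaseMul ω t).comp (Lp.fourierTransformₗᵢ ℝ ℂ).toLinearIsometry)

theorem phaseFlow_apply (ω : C(ℝ, ℝ)) (t : ℝ) (f : L2) :
    phaseFlow ω t f = (Lp.fourierTransformₗᵢ ℝ ℂ).symm (phaseMul ω t (𝓕 f : L2)) := rfl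

theorem fourier_phaseFlow (ω : C(ℝ, ℝ)) (t : ℝ) (f : L2) :
    (𝓕 (phaseFlow ω t f) : L2) = phaseMul ω t (𝓕 f : L2) :=
  (Lp.fourierTransformₗᵢ ℝ ℂ).apply_symm_apply _

theorem phaseFlow_comm (ω ω' : C(ℝ, ℝ)) (t t' : ℝ) (f : L2) :
    phaseFlow ω t (phaseFlow ω' t' f) = phaseFlow ω' t' (phaseFlow ω t f) := by
  rw [phaseFlow_apply, fourier_phaseFlow, phaseMul_comm, phaseFlow_apply ω', fourier_phaseFlow]

theorem phaseFlow_neg_cancel (ω : C(ℝ, ℝ)) (t : ℝ) (f : L2) :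
    phaseFlow ω (-t) (phaseFlow ω t f) = f := by
  rw [phaseFlow_apply, fourier_phaseFlow, phaseMul_neg_cancel]
  exact (Lp.fourierTransformₗᵢ ℝ ℂ).symm_apply_apply f

theorem phaseFlow_cancel_neg (ω : C(ℝ, ℝ)) (t : ℝ) (f : L2) :
    phaseFlow ω t (phaseFlow ω (-t) f) = f := by
  simpa using phaseFlow_neg_cancel ω (-t) f

@[simp]
theorem phaseFlow_zero (ω : C(ℝ, ℝ)) (f : L2) : phaseFlow ω 0 f = f := by
  rw [phaseFlow_apply, phaseMul_zero]
  exact (Lp.fourierTransformₗᵢ ℝ ℂ).symm_apply_apply f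

theorem continuous_phaseFlow (ω : C(ℝ, ℝ)) (f : L2) : Continuous fun t => phaseFlow ω t f :=
  (Lp.fourierTransformₗᵢ ℝ ℂ).symm.continuous.comp (continuous_phaseMul ω _)

theorem hasDerivAt_phaseFlow (ω : C(ℝ, ℝ)) (f Df : L2)
    (h : ∀ᵐ ξ, (𝓕 Df : L2) ξ = (ω ξ : ℂ) * (𝓕 f : L2) ξ) (t : ℝ) :
    HasDerivAt (fun τ => phaseFlow ω τ f) (phaseFlow ω t (Complex.I • Df)) t := by
  have h1 := hasDerivAt_phaseMul ω (𝓕 f : L2) (𝓕 Df : L2) h t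
  have h2 : (𝓕 (Complex.I • Df) : L2) = Complex.I • (𝓕 Df : L2) :=
    FourierTransform.fourier_smul _ _
  rw [phaseFlow_apply, h2]
  exact ((Lp.fourierTransformₗᵢ ℝ ℂ).symm.toContinuousLinearEquiv.toContinuousLinearMap.restrictScalars
    ℝ).hasFDerivAt.comp_hasDerivAt t h1

/-- Joint continuity of a strongly continuous family of isometries. -/
theorem tendsto_isometry_family {X α : Type*} [NormedAddCommGroup X] [NormedSpace ℂ X]
    (P : ℝ → X →ₗᵢ[ℂ] X) (hP : ∀ x, Continuous fun t => P t x) {l : Filter α} {τ : α → ℝ}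
    {u : α → X} {t : ℝ} {x : X} (hτ : Tendsto τ l (𝓝 t)) (hu : Tendsto u l (𝓝 x)) :
    Tendsto (fun a => P (τ a) (u a)) l (𝓝 (P t x)) := by
  rw [tendsto_iff_norm_sub_tendsto_zero] at hu ⊢
  have h1 : Tendsto (fun a => ‖P (τ a) x - P t x‖) l (𝓝 0) :=
    tendsto_iff_norm_sub_tendsto_zero.1 (((hP x).tendsto t).comp hτ)
  refine squeeze_zero (fun _ => norm_nonneg _) (fun a => ?_) (by simpa using hu.add h1)
  calc ‖P (τ a) (u a) - P t x‖ = ‖P (τ a) (u a - x) + (P (τ a) x - P t x)‖ := by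
        rw [map_sub]; congr 1; abel
    _ ≤ ‖u a - x‖ + ‖P (τ a) x - P t x‖ := by
        refine (norm_add_le _ _).trans_eq ?_
        rw [LinearIsometry.norm_map]

/-- The product rule for `t ↦ exp(i c t ω(D)) u(t)`. -/
theorem hasDerivWithinAt_phaseFlow_comp (ω : C(ℝ, ℝ)) (c : ℝ) {u : ℝ → L2} {u' Du : L2}
    {S : Set ℝ} {t : ℝ} (hu : HasDerivWithinAt u u' S t)
    (h : ∀ᵐ ξ, (𝓕 Du : L2) ξ = (ω ξ : ℂ) * (𝓕 (u t) : L2) ξ) :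
    HasDerivWithinAt (fun τ => phaseFlow ω (c * τ) (u τ))
      (phaseFlow ω (c * t) (u' + (c * Complex.I : ℂ) • Du)) S t := by
  have hc : HasDerivAt (fun τ : ℝ => c * τ) c t := by
    simpa using (hasDerivAt_id t).const_mul c
  have h1 : HasDerivWithinAt (fun τ => phaseFlow ω (c * τ) (u t))
      (phaseFlow ω (c * t) ((c * Complex.I : ℂ) • Du)) S t := by
    have := (HasDerivAt.scomp t (hasDerivAt_phaseFlow ω (u t) Du h (c * t)) hc).hasDerivWithinAt
      (s := S)
    convert! this using 1
    rw [mul_smul, map_smul _ (c : ℂ), L2_coe_smul]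
  -- The product is split about the fixed vector `u t`. Only that vector has to lie in the domain of
  -- `ω(D)`; the slopes of `u` are transported by joint strong continuity.
  have h2 : HasDerivWithinAt (fun τ => phaseFlow ω (c * τ) (u τ - u t))
      (phaseFlow ω (c * t) u') S t := by
    rw [hasDerivWithinAt_iff_tendsto_slope] at hu ⊢
    have hτ : Tendsto (fun τ : ℝ => c * τ) (𝓝[S \ {t}] t) (𝓝 (c * t)) :=
      hc.continuousAt.tendsto.mono_left nhdsWithin_le_nhds
    refine (tendsto_isometry_family (phaseFlow ω) (continuous_phaseFlow ω) hτ hu).congr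
      fun τ => ?_
    simp only [slope, vsub_eq_sub, sub_self, map_zero, sub_zero]
    rw [← L2_coe_smul, ← L2_coe_smul, map_smul]
  have h3 := h2.add h1
  rw [← map_add] at h3
  refine h3.congr_of_eventuallyEq (Eventually.of_forall fun τ => ?_) ?_
  · simp only [Pi.add_apply, ← map_add, sub_add_cancel]
  · simp

/-! ### The Fourier transform on `L²` and the Fourier integral -/

theorem continuous_fourierInv_of_integrable {g : ℝ → ℂ} (hg : Integrable g) : Continuous (𝓕⁻ g) :=
  VectorFourier.fourierIntegral_continuous Real.continuous_fourierChar
    (by simp only [LinearMap.neg_apply, innerₗ_apply_apply]; exact continuous_inner.neg) hg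

theorem norm_fourierInv_le (g : ℝ → ℂ) (x : ℝ) : ‖𝓕⁻ g x‖ ≤ ∫ ξ, ‖g ξ‖ :=
  VectorFourier.norm_fourierIntegral_le_integral_norm _ _ _ _ _

theorem L2_locallyIntegrable (f : L2) : LocallyIntegrable f volume :=
  (Lp.memLp f).locallyIntegrable (by norm_num)

/-- Fourier inversion for an `L²` function whose Fourier transform is integrable. -/
theorem ae_eq_fourierInv (f : L2) (hf : Integrable (𝓕 f : L2)) :
    f =ᵐ[volume] 𝓕⁻ ((𝓕 f : L2) : ℝ → ℂ) := by
  -- Both sides are tested against real bump functions: Plancherel moves the pairing with `f` to the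
  -- Fourier side, and Fubini moves it back onto the Fourier integral.
  refine ae_eq_of_integral_contDiff_smul_eq (L2_locallyIntegrable f)
    (continuous_fourierInv_of_integrable hf).locallyIntegrable fun g hg hgs => ?_
  have hs : HasCompactSupport (fun x => (g x : ℂ)) := hgs.comp_left Complex.ofReal_zero
  have hd : ContDiff ℝ (↑(⊤ : ℕ∞)) (fun x => (g x : ℂ)) := Complex.ofRealCLM.contDiff.comp hg
  set φ : SchwartzMap ℝ ℂ := hs.toSchwartzMap hd with hφ
  have hφx : ∀ x, φ x = (g x : ℂ) := fun x => rfl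
  have h1 : inner ℂ (φ.toLp 2 : L2) f = ∫ x, g x • f x := by
    rw [L2.inner_def]
    refine integral_congr_ae ?_
    filter_upwards [φ.coeFn_toLp 2 volume] with x hx
    rw [hx, hφx]
    simp [mul_comm]
  have h2 : inner ℂ (𝓕 (φ.toLp 2 : L2) : L2) (𝓕 f : L2) =
      ∫ ξ, innerSL ℂ (𝓕 (φ : ℝ → ℂ) ξ) ((𝓕 f : L2) ξ) := by
    rw [L2.inner_def]
    refine integral_congr_ae ?_
    rw [SchwartzMap.toLp_fourier_eq]
    filter_upwards [(𝓕 φ).coeFn_toLp 2 volume] with x hx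
    rw [hx, SchwartzMap.fourier_coe, innerSL_apply_apply]
  have h3 := VectorFourier.integral_sesq_fourierIntegral_eq_neg_flip (innerSL ℂ (E := ℂ))
    Real.continuous_fourierChar (L := innerₗ ℝ) continuous_inner
    (φ.integrable (μ := volume)) hf
  rw [← h1, ← Lp.inner_fourier_eq, h2]
  refine h3.trans (integral_congr_ae (Eventually.of_forall fun x => ?_))
  simp only [hφx, innerSL_apply_apply, flip_innerₗ]
  rw [RCLike.inner_apply, Complex.conj_ofReal, Complex.real_smul, mul_comm]
  rfl

/-- The Fourier symbol of translations. -/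
def translationSymbol : C(ℝ, ℝ) := ⟨fun ξ => 2 * Real.pi * ξ, by fun_prop⟩

/-- The translation `f ↦ f(· + h)`, written as a Fourier multiplier. -/
abbrev translate (h : ℝ) : L2 →ₗᵢ[ℂ] L2 := phaseFlow translationSymbol h

theorem translate_toLp (h : ℝ) (φ : SchwartzMap ℝ ℂ) :
    translate h (φ.toLp 2) = (φ.compSubConstCLM ℂ (-h)).toLp 2 := by
  have hinj := (Lp.fourierTransformₗᵢ ℝ ℂ).injective
  apply hinj
  change (𝓕 (translate h (φ.toLp 2)) : L2) = 𝓕 ((φ.compSubConstCLM ℂ (-h)).toLp 2 : L2)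
  rw [fourier_phaseFlow, SchwartzMap.toLp_fourier_eq, SchwartzMap.toLp_fourier_eq]
  apply Lp.ext
  filter_upwards [coeFn_phaseMul translationSymbol h ((𝓕 φ).toLp 2), (𝓕 φ).coeFn_toLp 2 volume,
    (𝓕 (φ.compSubConstCLM ℂ (-h))).coeFn_toLp 2 volume] with ξ h1 h2 h3
  rw [h1, h2, h3, SchwartzMap.fourier_coe, SchwartzMap.fourier_coe]
  have h4 : ((φ.compSubConstCLM ℂ (-h) : SchwartzMap ℝ ℂ) : ℝ → ℂ) = φ ∘ fun v => v + h := by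
    ext x
    simp [SchwartzMap.compSubConstCLM_apply]
  rw [h4]
  have h5 := congrFun (VectorFourier.fourierIntegral_comp_add_right Real.fourierChar volume
    (innerₗ ℝ) (φ : ℝ → ℂ) h) ξ
  refine Eq.trans ?_ h5.symm
  rw [Circle.smul_def, Real.fourierChar_apply]
  simp only [innerₗ_apply_apply, smul_eq_mul, phase, translationSymbol, ContinuousMap.coe_mk]
  congr 2
  simp
  ring

/-- The multiplier and the composition with the shift are isometries of `L²` that agree on the dense
set of Schwartz functions. -/
theorem coeFn_translate (h : ℝ) (f : L2) : translate h f =ᵐ[volume] fun x => f (x + h) := by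
  have hmp : MeasurePreserving (fun x : ℝ => x + h) volume volume :=
    measurePreserving_add_right volume h
  have key : translate h f = Lp.compMeasurePreserving _ hmp f := by
    have hd : DenseRange (SchwartzMap.toLpCLM ℝ ℂ 2 (volume : Measure ℝ)) :=
      SchwartzMap.denseRange_toLpCLM (by norm_num)
    refine congrFun (hd.equalizer (translate h).continuous
      (Lp.isometry_compMeasurePreserving hmp).continuous (funext fun φ => ?_)) f
    simp only [Function.comp_apply, SchwartzMap.toLpCLM_apply]
    rw [translate_toLp]
    apply Lp.ext
    filter_upwards [Lp.coeFn_compMeasurePreserving (φ.toLp 2 : L2) hmp,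
      (φ.compSubConstCLM ℂ (-h)).coeFn_toLp 2 volume,
      hmp.quasiMeasurePreserving.ae (φ.coeFn_toLp 2 volume)] with x h1 h2 h3
    rw [h1, h2, Function.comp_apply, h3]
    simp [SchwartzMap.compSubConstCLM_apply]
  rw [key]
  exact Lp.coeFn_compMeasurePreserving f hmp

/-- A nonlinearity without explicit dependence on `x` commutes with shifts. Translates of solutions
are therefore solutions, the source of the `H¹` bounds. -/
theorem translate_compLp {N : ℂ → ℂ} {K : NNReal} (hN : LipschitzWith K N) (h0 : N 0 = 0) (h : ℝ)
    (f : L2) : translate h (hN.compLp h0 f) = hN.compLp h0 (translate h f) := by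
  have hmp : MeasurePreserving (fun x : ℝ => x + h) volume volume :=
    measurePreserving_add_right volume h
  apply Lp.ext
  filter_upwards [coeFn_translate h (hN.compLp h0 f), coeFn_translate h f,
    hN.coeFn_compLp h0 (translate h f),
    hmp.quasiMeasurePreserving.ae (hN.coeFn_compLp h0 f)] with x h1 h2 h3 h4
  rw [h1, h3, h4, Function.comp_apply, Function.comp_apply, h2]

/-! ### The spaces `H^s` -/

theorem besselSymbol_pos (s ξ : ℝ) : 0 < besselSymbol s ξ := by
  unfold besselSymbol
  positivity

theorem one_le_besselSymbol {s : ℝ} (hs : 0 ≤ s) (ξ : ℝ) : 1 ≤ besselSymbol s ξ :=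
  Real.one_le_rpow (by nlinarith [sq_nonneg (2 * Real.pi * ξ)]) (by linarith)

theorem besselSymbol_mono {s s' : ℝ} (h : s ≤ s') (ξ : ℝ) :
    besselSymbol s ξ ≤ besselSymbol s' ξ :=
  Real.rpow_le_rpow_of_exponent_le (by nlinarith [sq_nonneg (2 * Real.pi * ξ)]) (by linarith)

theorem besselSymbol_one_sq (ξ : ℝ) : besselSymbol 1 ξ ^ 2 = 1 + (2 * Real.pi * ξ) ^ 2 := by
  rw [besselSymbol, ← Real.rpow_natCast, ← Real.rpow_mul (by positivity)]
  norm_num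

theorem continuous_besselSymbol (s : ℝ) : Continuous (besselSymbol s) := by
  unfold besselSymbol
  refine Continuous.rpow_const (by fun_prop) fun ξ => Or.inl ?_
  positivity

theorem Hs.coeFn_weightedFourier {s : ℝ} (f : Hs s) :
    Hs.weightedFourier s f =ᵐ[volume] fun ξ => (besselSymbol s ξ : ℂ) * (𝓕 f.toL2 : L2) ξ :=
  MemLp.coeFn_toLp f.memLp

theorem Hs.norm_eq {s : ℝ} (f : Hs s) : ‖f‖ = ‖Hs.weightedFourier s f‖ := rfl

theorem Hs.toL2_injective {s : ℝ} : Function.Injective (Hs.toL2 : Hs s → L2) :=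
  Subtype.val_injective

theorem Hs.exists_toL2_eq {s : ℝ} {f : L2} (hf : f ∈ sobolevSubmodule s) :
    ∃ g : Hs s, g.toL2 = f := ⟨⟨f, hf⟩, rfl⟩

theorem Hs.norm_toL2_le {s : ℝ} (hs : 0 ≤ s) (f : Hs s) : ‖f.toL2‖ ≤ ‖f‖ := by
  have h1 : ‖(𝓕 f.toL2 : L2)‖ = ‖f.toL2‖ := Lp.norm_fourier_eq _
  rw [← h1, Hs.norm_eq]
  refine Lp.norm_le_norm_of_ae_le ?_
  filter_upwards [f.coeFn_weightedFourier] with ξ hξ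
  rw [hξ, norm_mul, Complex.norm_real, Real.norm_of_nonneg (besselSymbol_pos s ξ).le]
  exact le_mul_of_one_le_left (norm_nonneg _) (one_le_besselSymbol hs ξ)

theorem Hs.weightedFourier_surjective {s : ℝ} (hs : 0 ≤ s) :
    Function.Surjective (Hs.weightedFourier s) := by
  intro g
  have hmem : MemLp (fun ξ => ((besselSymbol s ξ)⁻¹ : ℂ) * g ξ) 2 volume := by
    refine (Lp.memLp g).of_le (Continuous.aestronglyMeasurable ?_ |>.mul
      (Lp.aestronglyMeasurable g)) (Eventually.of_forall fun ξ => ?_)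
    · exact (Complex.continuous_ofReal.comp (continuous_besselSymbol s)).inv₀ fun ξ => by
        simpa using (besselSymbol_pos s ξ).ne'
    · rw [norm_mul, norm_inv, Complex.norm_real, Real.norm_of_nonneg (besselSymbol_pos s ξ).le]
      exact mul_le_of_le_one_left (norm_nonneg _) (inv_le_one_of_one_le₀ (one_le_besselSymbol hs ξ))
  set f : L2 := (Lp.fourierTransformₗᵢ ℝ ℂ).symm hmem.toLp
  have hf : (𝓕 f : L2) = hmem.toLp := (Lp.fourierTransformₗᵢ ℝ ℂ).apply_symm_apply _
  have hae : (fun ξ => (besselSymbol s ξ : ℂ) * (𝓕 f : L2) ξ) =ᵐ[volume] g := by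
    rw [hf]
    filter_upwards [hmem.coeFn_toLp] with ξ hξ
    have : (besselSymbol s ξ : ℂ) ≠ 0 := by exact_mod_cast (besselSymbol_pos s ξ).ne'
    rw [hξ, mul_inv_cancel_left₀ this]
  obtain ⟨k, hk⟩ := Hs.exists_toL2_eq (s := s) (f := f) ((Lp.memLp g).ae_eq hae.symm)
  refine ⟨k, Lp.ext (k.coeFn_weightedFourier.trans ?_)⟩
  rw [hk]
  exact hae

/-- `H^s` is isometric to `L²`. -/
def Hs.equivL2 {s : ℝ} (hs : 0 ≤ s) : Hs s ≃ₗᵢ[ℂ] L2 :=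
  { LinearEquiv.ofBijective (Hs.weightedFourier s)
      ⟨Hs.weightedFourier_injective s, Hs.weightedFourier_surjective hs⟩ with
    norm_map' := fun _ => rfl }

theorem Hs.completeSpace {s : ℝ} (hs : 0 ≤ s) : CompleteSpace (Hs s) :=
  (completeSpace_congr (e := (Hs.equivL2 hs).toLinearEquiv.toEquiv)
    (Hs.equivL2 hs).isometry.isUniformEmbedding).2 inferInstance

/-- The continuous inclusion of `H^s` into `L²`, as a real linear map. -/
def Hs.toL2CLM {s : ℝ} (hs : 0 ≤ s) : Hs s →L[ℝ] L2 :=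
  LinearMap.mkContinuous
    { toFun := Hs.toL2
      map_add' := map_add _
      map_smul' := fun c f => by
        rw [RingHom.id_apply, ← L2_coe_smul, ← map_smul]
        rfl } 1 fun f => by simpa using f.norm_toL2_le hs

theorem Hs.toL2CLM_apply {s : ℝ} (hs : 0 ≤ s) (f : Hs s) : Hs.toL2CLM hs f = f.toL2 := rfl

/-- The Fourier multiplier `exp(i t ω(ξ))` on `H^s`. -/
def Hs.phaseFlow {s : ℝ} (hs : 0 ≤ s) (ω : C(ℝ, ℝ)) (t : ℝ) : Hs s →ₗᵢ[ℂ] Hs s :=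
  (Hs.equivL2 hs).symm.toLinearIsometry.comp
    ((phaseMul ω t).comp (Hs.equivL2 hs).toLinearIsometry)

theorem Hs.weightedFourier_phaseFlow {s : ℝ} (hs : 0 ≤ s) (ω : C(ℝ, ℝ)) (t : ℝ) (f : Hs s) :
    Hs.weightedFourier s (Hs.phaseFlow hs ω t f) = phaseMul ω t (Hs.weightedFourier s f) :=
  (Hs.equivL2 hs).apply_symm_apply _

theorem Hs.toL2_phaseFlow {s : ℝ} (hs : 0 ≤ s) (ω : C(ℝ, ℝ)) (t : ℝ) (f : Hs s) :
    (Hs.phaseFlow hs ω t f).toL2 = Semirelativistic.phaseFlow ω t f.toL2 := by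
  apply (Lp.fourierTransformₗᵢ ℝ ℂ).injective
  change (𝓕 (Hs.phaseFlow hs ω t f).toL2 : L2) = 𝓕 (Semirelativistic.phaseFlow ω t f.toL2)
  rw [fourier_phaseFlow]
  apply Lp.ext
  have h0 := (Hs.phaseFlow hs ω t f).coeFn_weightedFourier
  rw [Hs.weightedFourier_phaseFlow] at h0
  filter_upwards [h0, coeFn_phaseMul ω t (Hs.weightedFourier s f), f.coeFn_weightedFourier,
    coeFn_phaseMul ω t (𝓕 f.toL2 : L2)] with ξ h1 h2 h3 h4
  have hb : (besselSymbol s ξ : ℂ) ≠ 0 := by exact_mod_cast (besselSymbol_pos s ξ).ne'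
  rw [h4]
  refine mul_left_cancel₀ hb ?_
  rw [← h1, h2, h3]
  ring

theorem Hs.continuous_phaseFlow {s : ℝ} (hs : 0 ≤ s) (ω : C(ℝ, ℝ)) (f : Hs s) :
    Continuous fun t => Hs.phaseFlow hs ω t f :=
  (Hs.equivL2 hs).symm.continuous.comp (continuous_phaseMul ω _)

/-! ### `H¹` and translations -/

/-- `f` is Lipschitz, with constant `R`, under translations. -/
def TranslationBound (f : L2) (R : ℝ) : Prop := ∀ h, ‖translate h f - f‖ ≤ R * |h|

theorem fourier_sub_L2 (f g : L2) : (𝓕 (f - g) : L2) = 𝓕 f - 𝓕 g :=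
  (Lp.fourierTransformₗᵢ ℝ ℂ).map_sub f g

theorem coeFn_fourier_translate_sub (h : ℝ) (f : L2) :
    (𝓕 (translate h f - f) : L2) =ᵐ[volume]
      fun ξ => (phase translationSymbol h ξ - 1) * (𝓕 f : L2) ξ := by
  rw [fourier_sub_L2, fourier_phaseFlow]
  filter_upwards [Lp.coeFn_sub (phaseMul translationSymbol h (𝓕 f : L2)) (𝓕 f : L2),
    coeFn_phaseMul translationSymbol h (𝓕 f : L2)] with ξ h1 h2
  rw [h1, Pi.sub_apply, h2]
  ring

theorem norm_phase_translationSymbol_sub_one_le (h ξ : ℝ) :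
    ‖phase translationSymbol h ξ - 1‖ ≤ |h| * |2 * Real.pi * ξ| := by
  have := Real.norm_exp_I_mul_ofReal_sub_one_le (x := h * (2 * Real.pi * ξ))
  rw [mul_comm Complex.I] at this
  rwa [Real.norm_eq_abs, abs_mul] at this

/-- On the Fourier side, `|exp(2πihξ) - 1| ≤ |h||2πξ|`, and `|2πξ|` is below the Bessel weight. The
converse for `s = 1` is `TranslationBound.exists_Hs`. -/
theorem Hs.translationBound {s : ℝ} (hs : 1 ≤ s) (f : Hs s) : TranslationBound f.toL2 ‖f‖ := by
  intro h
  rw [← Lp.norm_fourier_eq, Hs.norm_eq, mul_comm, ← Real.norm_eq_abs, ← Complex.norm_real,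
    ← norm_smul]
  refine Lp.norm_le_norm_of_ae_le ?_
  filter_upwards [coeFn_fourier_translate_sub h f.toL2, f.coeFn_weightedFourier,
    Lp.coeFn_smul (h : ℂ) (Hs.weightedFourier s f)] with ξ h1 h2 h3
  rw [h1, h3, Pi.smul_apply, h2, smul_eq_mul, norm_mul, norm_mul, norm_mul, ← mul_assoc,
    Complex.norm_real, Complex.norm_real, Real.norm_of_nonneg (besselSymbol_pos s ξ).le,
    Real.norm_eq_abs]
  refine mul_le_mul_of_nonneg_right ?_ (norm_nonneg _)
  refine (norm_phase_translationSymbol_sub_one_le h ξ).trans ?_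
  refine mul_le_mul_of_nonneg_left ?_ (abs_nonneg h)
  refine le_trans ?_ (besselSymbol_mono hs ξ)
  refine abs_le_of_sq_le_sq ?_ (besselSymbol_pos 1 ξ).le
  rw [besselSymbol_one_sq]
  linarith

/-- Fatou's lemma for the difference quotients with steps `1/(n+1)`: their Fourier transforms
converge pointwise to that of the derivative, with `L²` norms at most `R`. -/
theorem TranslationBound.eLpNorm_le {f : L2} {R : ℝ} (hR : TranslationBound f R) :
    eLpNorm (fun ξ : ℝ => (2 * Real.pi * ξ * Complex.I : ℂ) * (𝓕 f : L2) ξ) 2 volume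
      ≤ ENNReal.ofReal R := by
  set k : ℕ → ℝ := fun n => ((n : ℝ) + 1)⁻¹ with hk
  have hkpos : ∀ n, 0 < k n := fun n => by rw [hk]; positivity
  have hk0 : Tendsto k atTop (𝓝[≠] 0) := by
    refine tendsto_nhdsWithin_iff.2 ⟨?_, Eventually.of_forall fun n => (hkpos n).ne'⟩
    simpa [hk] using tendsto_one_div_add_atTop_nhds_zero_nat (𝕜 := ℝ)
  set G : ℕ → L2 := fun n => ((k n)⁻¹ : ℂ) • (𝓕 (translate (k n) f - f) : L2)
  have hG : ∀ n, ∀ᵐ ξ, G n ξ = ((k n)⁻¹ : ℂ) * ((phase translationSymbol (k n) ξ - 1) *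
      (𝓕 f : L2) ξ) := fun n => by
    filter_upwards [Lp.coeFn_smul ((k n)⁻¹ : ℂ) (𝓕 (translate (k n) f - f) : L2),
      coeFn_fourier_translate_sub (k n) f] with ξ h1 h2
    rw [h1, Pi.smul_apply, h2, smul_eq_mul]
  have hlim : ∀ᵐ ξ : ℝ, Tendsto (fun n => G n ξ) atTop
      (𝓝 ((2 * Real.pi * ξ * Complex.I : ℂ) * (𝓕 f : L2) ξ)) := by
    filter_upwards [ae_all_iff.2 hG] with ξ hξ
    simp_rw [hξ, ← mul_assoc]
    refine Tendsto.mul_const _ ?_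
    have hd : HasDerivAt (fun h : ℝ => phase translationSymbol h ξ)
        (2 * Real.pi * ξ * Complex.I : ℂ) 0 := by
      have h1 : HasDerivAt (fun h : ℝ => (h : ℂ) * (2 * Real.pi * ξ * Complex.I : ℂ))
          (2 * Real.pi * ξ * Complex.I : ℂ) 0 := by
        simpa using (Complex.ofRealCLM.hasDerivAt (x := (0 : ℝ))).mul_const
          (2 * Real.pi * ξ * Complex.I : ℂ)
      have h2 := h1.cexp
      simp only [Complex.ofReal_zero, zero_mul, Complex.exp_zero, one_mul] at h2
      refine h2.congr_of_eventuallyEq (Eventually.of_forall fun h => ?_)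
      simp only [phase, translationSymbol, ContinuousMap.coe_mk]
      push_cast
      ring_nf
    have h3 := hd.tendsto_slope_zero.comp hk0
    refine h3.congr fun n => ?_
    simp
  refine (Lp.eLpNorm_lim_le_liminf_eLpNorm (fun n => Lp.aestronglyMeasurable (G n)) _ hlim).trans ?_
  refine (liminf_le_liminf (v := fun _ => ENNReal.ofReal R) (Eventually.of_forall fun n => ?_)).trans
    (by simp)
  rw [← Lp.enorm_def, ← ofReal_norm]
  refine ENNReal.ofReal_le_ofReal ?_
  rw [norm_smul, Lp.norm_fourier_eq, norm_inv, Complex.norm_real,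
    Real.norm_of_nonneg (hkpos n).le, inv_mul_le_iff₀ (hkpos n), mul_comm]
  simpa [abs_of_pos (hkpos n)] using hR (k n)

/-- The derivative of an `L²` function that is Lipschitz under translations. -/
theorem TranslationBound.integral_sq_le {f : L2} {R : ℝ} (hR : TranslationBound f R)
    (hR0 : 0 ≤ R) :
    Integrable (fun ξ : ℝ => (2 * Real.pi * ξ) ^ 2 * ‖(𝓕 f : L2) ξ‖ ^ 2) ∧
      ∫ ξ : ℝ, (2 * Real.pi * ξ) ^ 2 * ‖(𝓕 f : L2) ξ‖ ^ 2 ≤ R ^ 2 := by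
  have hle := hR.eLpNorm_le
  have hmem : MemLp (fun ξ : ℝ => (2 * Real.pi * ξ * Complex.I : ℂ) * (𝓕 f : L2) ξ) 2 volume :=
    ⟨Continuous.aestronglyMeasurable (by fun_prop) |>.mul (Lp.aestronglyMeasurable _),
      hle.trans_lt ENNReal.ofReal_lt_top⟩
  have hpt : ∀ ξ : ℝ, ‖(2 * Real.pi * ξ * Complex.I : ℂ) * (𝓕 f : L2) ξ‖ ^ 2 =
      (2 * Real.pi * ξ) ^ 2 * ‖(𝓕 f : L2) ξ‖ ^ 2 := fun ξ => by
    rw [norm_mul, mul_pow]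
    congr 1
    have : (2 * Real.pi * ξ * Complex.I : ℂ) = ((2 * Real.pi * ξ : ℝ) : ℂ) * Complex.I := by
      push_cast
      ring
    rw [this, norm_mul, Complex.norm_real, Complex.norm_I, mul_one, Real.norm_eq_abs, sq_abs]
  refine ⟨?_, ?_⟩
  · simpa only [hpt] using (memLp_two_iff_integrable_sq_norm hmem.1).1 hmem
  · have h1 : ‖hmem.toLp‖ ≤ R := by
      rw [Lp.norm_toLp]
      exact ENNReal.toReal_le_of_le_ofReal hR0 hle
    have h2 := L2_norm_sq hmem.toLp
    have h3 : (∫ ξ, ‖(hmem.toLp : L2) ξ‖ ^ 2) =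
        ∫ ξ : ℝ, (2 * Real.pi * ξ) ^ 2 * ‖(𝓕 f : L2) ξ‖ ^ 2 := by
      refine integral_congr_ae ?_
      filter_upwards [hmem.coeFn_toLp] with ξ hξ
      rw [hξ, hpt]
    rw [← h3, ← h2]
    gcongr

/-- The square of the Bessel weight of order 1 is `1 + (2πξ)²`, so the two parts are controlled by
`‖f‖` and by the translation bound. This is how `H¹` is recovered from estimates made purely in
`L²`. -/
theorem TranslationBound.exists_Hs {f : L2} {R : ℝ} (hR : TranslationBound f R) (hR0 : 0 ≤ R) :
    ∃ g : Hs 1, g.toL2 = f ∧ ‖g‖ ^ 2 ≤ ‖f‖ ^ 2 + R ^ 2 := by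
  obtain ⟨hint, hle⟩ := hR.integral_sq_le hR0
  have hpt : ∀ ξ : ℝ, ‖(besselSymbol 1 ξ : ℂ) * (𝓕 f : L2) ξ‖ ^ 2 =
      ‖(𝓕 f : L2) ξ‖ ^ 2 + (2 * Real.pi * ξ) ^ 2 * ‖(𝓕 f : L2) ξ‖ ^ 2 := fun ξ => by
    rw [norm_mul, mul_pow, Complex.norm_real, Real.norm_eq_abs, sq_abs, besselSymbol_one_sq]
    ring
  have hmem : f ∈ sobolevSubmodule 1 := by
    change MemLp (fun ξ : ℝ => (besselSymbol 1 ξ : ℂ) * (𝓕 f : L2) ξ) 2 volume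
    refine (memLp_two_iff_integrable_sq_norm ?_).2 ?_
    · exact (Complex.continuous_ofReal.comp (continuous_besselSymbol 1)).aestronglyMeasurable.mul
        (Lp.aestronglyMeasurable _)
    · simp only [hpt]
      exact (L2_integrable_norm_sq (𝓕 f : L2)).add hint
  obtain ⟨g, hg⟩ := Hs.exists_toL2_eq hmem
  refine ⟨g, hg, ?_⟩
  rw [Hs.norm_eq, L2_norm_sq]
  have h1 : (∫ ξ, ‖Hs.weightedFourier 1 g ξ‖ ^ 2) = ∫ ξ : ℝ, (‖(𝓕 f : L2) ξ‖ ^ 2 +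
      (2 * Real.pi * ξ) ^ 2 * ‖(𝓕 f : L2) ξ‖ ^ 2) := by
    refine integral_congr_ae ?_
    filter_upwards [g.coeFn_weightedFourier] with ξ hξ
    rw [hξ, ← hpt, hg]
  rw [h1, integral_add (L2_integrable_norm_sq _) hint, ← L2_norm_sq, Lp.norm_fourier_eq]
  linarith

/-! ### The embedding of `H¹` into bounded functions -/

theorem integrable_inv_sq_add {a : ℝ} (ha : 0 < a) :
    Integrable (fun ξ : ℝ => (a ^ 2 + (2 * Real.pi * ξ) ^ 2)⁻¹) ∧
      ∫ ξ : ℝ, (a ^ 2 + (2 * Real.pi * ξ) ^ 2)⁻¹ = (2 * a)⁻¹ := by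
  have hc : (2 * Real.pi / a) ≠ 0 := by positivity
  have hpt : ∀ ξ : ℝ, (a ^ 2 + (2 * Real.pi * ξ) ^ 2)⁻¹ =
      (a ^ 2)⁻¹ * (1 + (2 * Real.pi / a * ξ) ^ 2)⁻¹ := fun ξ => by
    rw [← mul_inv]
    congr 1
    field_simp
  simp_rw [hpt]
  refine ⟨(integrable_inv_one_add_sq.comp_mul_left' hc).const_mul _, ?_⟩
  rw [integral_const_mul, Measure.integral_comp_mul_left (fun x => (1 + x ^ 2)⁻¹),
    integral_univ_inv_one_add_sq, abs_of_pos (by positivity), smul_eq_mul]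
  field_simp

/-- The Fourier transform of an `H¹` function is integrable. -/
theorem TranslationBound.integral_fourier_le {f : L2} {R : ℝ} (hR : TranslationBound f R)
    (hR0 : 0 ≤ R) {a μ : ℝ} (ha : 0 < a) (hμ : 0 < μ) :
    Integrable (𝓕 f : L2) ∧
      ∫ ξ, ‖(𝓕 f : L2) ξ‖ ≤ μ / a + (a ^ 2 * ‖f‖ ^ 2 + R ^ 2) / μ := by
  obtain ⟨hint, hle⟩ := hR.integral_sq_le hR0
  obtain ⟨hi1, hi2⟩ := integrable_inv_sq_add ha
  have hsum' : Integrable (fun ξ : ℝ => a ^ 2 * ‖(𝓕 f : L2) ξ‖ ^ 2 +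
      (2 * Real.pi * ξ) ^ 2 * ‖(𝓕 f : L2) ξ‖ ^ 2) :=
    ((L2_integrable_norm_sq _).const_mul _).add hint
  have hsum : Integrable (fun ξ : ℝ => μ * (a ^ 2 + (2 * Real.pi * ξ) ^ 2)⁻¹ +
      μ⁻¹ * (a ^ 2 * ‖(𝓕 f : L2) ξ‖ ^ 2 + (2 * Real.pi * ξ) ^ 2 * ‖(𝓕 f : L2) ξ‖ ^ 2)) :=
    (hi1.const_mul _).add (hsum'.const_mul _)
  -- Young's inequality `y ≤ μ/c + c y²/μ` with `c = a² + (2πξ)²`. The free parameter `a` balances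
  -- `f` against its derivative, and `μ` balances the two terms.
  have hpt : ∀ ξ : ℝ, ‖(𝓕 f : L2) ξ‖ ≤ μ * (a ^ 2 + (2 * Real.pi * ξ) ^ 2)⁻¹ +
      μ⁻¹ * (a ^ 2 * ‖(𝓕 f : L2) ξ‖ ^ 2 + (2 * Real.pi * ξ) ^ 2 * ‖(𝓕 f : L2) ξ‖ ^ 2) := by
    intro ξ
    set c := a ^ 2 + (2 * Real.pi * ξ) ^ 2 with hc
    set y := ‖(𝓕 f : L2) ξ‖
    have hcpos : 0 < c := by positivity
    have hy : 0 ≤ y := norm_nonneg _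
    have h1 : μ * c⁻¹ + μ⁻¹ * (a ^ 2 * y ^ 2 + (2 * Real.pi * ξ) ^ 2 * y ^ 2) - y =
        (μ ^ 2 + (c * y) ^ 2 - μ * (c * y)) / (μ * c) := by
      rw [← add_mul, ← hc]
      field_simp
    have h2 : 0 ≤ (μ ^ 2 + (c * y) ^ 2 - μ * (c * y)) / (μ * c) :=
      div_nonneg (by nlinarith [sq_nonneg (μ - c * y), mul_pos hμ hcpos, sq_nonneg (c * y)])
        (by positivity)
    linarith
  refine ⟨hsum.mono' (Lp.aestronglyMeasurable _) (Eventually.of_forall hpt), ?_⟩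
  refine (integral_mono_of_nonneg (Eventually.of_forall fun _ => norm_nonneg _) hsum
    (Eventually.of_forall hpt)).trans ?_
  rw [integral_add (hi1.const_mul _) (hsum'.const_mul _), integral_const_mul,
    integral_const_mul, integral_add ((L2_integrable_norm_sq _).const_mul _) hint,
    integral_const_mul, ← L2_norm_sq, Lp.norm_fourier_eq, hi2]
  refine add_le_add ?_ ?_
  · rw [div_eq_mul_inv]
    gcongr
    linarith
  · rw [div_eq_inv_mul]
    gcongr

theorem TranslationBound.ae_norm_le {f : L2} {R : ℝ} (hR : TranslationBound f R) (hR0 : 0 ≤ R)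
    {a μ : ℝ} (ha : 0 < a) (hμ : 0 < μ) :
    ∀ᵐ x, ‖f x‖ ≤ μ / a + (a ^ 2 * ‖f‖ ^ 2 + R ^ 2) / μ := by
  obtain ⟨hi, hle⟩ := hR.integral_fourier_le hR0 ha hμ
  filter_upwards [ae_eq_fourierInv f hi] with x hx
  rw [hx]
  exact (norm_fourierInv_le _ x).trans hle

/-- A sequence that is bounded in `H¹` and small in `L²` is small in `L^∞`. -/
theorem exists_delta_ae_norm_le {R : ℝ} (hR0 : 0 ≤ R) {ε : ℝ} (hε : 0 < ε) :
    ∃ δ > 0, ∀ f : L2, TranslationBound f R → ‖f‖ ≤ δ → ∀ᵐ x, ‖f x‖ ≤ ε := by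
  -- The order of choice matters: `μ` makes `(1 + R²)/μ` equal to `ε/4`, then `a` makes `μ/a` equal
  -- to `ε/2`, and finally `δ = 1/a` makes `a²‖f‖² ≤ 1`.
  set μ : ℝ := 4 * (R ^ 2 + 1) / ε
  have hμ : 0 < μ := by positivity
  set a : ℝ := 2 * μ / ε
  have ha : 0 < a := by positivity
  refine ⟨a⁻¹, by positivity, fun f hf hδ => ?_⟩
  filter_upwards [hf.ae_norm_le hR0 ha hμ] with x hx
  refine hx.trans ?_
  have h1 : μ / a = ε / 2 := by
    simp only [a]
    field_simp
  have h2 : a ^ 2 * ‖f‖ ^ 2 ≤ 1 := by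
    rw [← mul_pow]
    refine pow_le_one₀ (by positivity) ?_
    rwa [mul_comm, ← le_div_iff₀ ha, one_div]
  have h3 : (a ^ 2 * ‖f‖ ^ 2 + R ^ 2) / μ ≤ ε / 4 := by
    rw [div_le_iff₀ hμ]
    have : ε / 4 * μ = R ^ 2 + 1 := by
      simp only [μ]
      field_simp
    linarith
  linarith

/-! ### The power nonlinearity -/

/-- The nonlinearity `|z|^{p-1} z`. -/
def powNL (p : ℝ) (z : ℂ) : ℂ := ((‖z‖ ^ (p - 1) : ℝ) : ℂ) * z

theorem powNL_eq_smul (p : ℝ) (z : ℂ) : powNL p z = ‖z‖ ^ (p - 1) • z := by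
  rw [powNL, Complex.real_smul]

theorem norm_powNL {p : ℝ} (hp : 1 < p) (z : ℂ) : ‖powNL p z‖ = ‖z‖ ^ p := by
  rw [powNL_eq_smul, norm_smul, Real.norm_of_nonneg (by positivity)]
  rcases eq_or_ne z 0 with rfl | hz
  · rw [norm_zero, mul_zero, Real.zero_rpow (by linarith)]
  · rw [← Real.rpow_add_one (norm_ne_zero_iff.2 hz)]
    ring_nf

theorem rpow_sub_rpow_le {p x y : ℝ} (hp : 1 < p) (hy : 0 ≤ y) (hxy : y ≤ x) :
    x ^ p - y ^ p ≤ p * x ^ (p - 1) * (x - y) := by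
  have hd : ∀ t ∈ Set.Icc y x, HasDerivWithinAt (fun t : ℝ => t ^ p) (p * t ^ (p - 1))
      (Set.Icc y x) t := fun t _ => (Real.hasDerivAt_rpow_const (Or.inr hp.le)).hasDerivWithinAt
  have h := (convex_Icc y x).norm_image_sub_le_of_norm_hasDerivWithin_le hd
    (C := p * x ^ (p - 1)) (fun t ht => ?_) (Set.left_mem_Icc.2 hxy) (Set.right_mem_Icc.2 hxy)
  · rw [Real.norm_of_nonneg (sub_nonneg.2 hxy)] at h
    exact (le_abs_self _).trans h
  · have ht0 : 0 ≤ t := hy.trans ht.1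
    rw [Real.norm_of_nonneg (by positivity)]
    have := Real.rpow_le_rpow ht0 ht.2 (show 0 ≤ p - 1 by linarith)
    gcongr

/-- The factor `|z|^{p-1}` need not be Lipschitz at the origin, so its increment is never estimated
alone: multiplied by the smaller modulus, it is at most `|a|^p - |b|^p`, to which the mean value
bound applies. -/
theorem norm_powNL_sub_le {p : ℝ} (hp : 1 < p) {M : ℝ} {a b : ℂ} (ha : ‖a‖ ≤ M) (hb : ‖b‖ ≤ M) :
    ‖powNL p a - powNL p b‖ ≤ (1 + p) * M ^ (p - 1) * ‖a - b‖ := by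
  wlog h : ‖b‖ ≤ ‖a‖ generalizing a b
  · rw [norm_sub_rev, norm_sub_rev a b]
    exact this hb ha (le_of_not_ge h)
  have hp1 : 0 ≤ p - 1 := by linarith
  have h1 : powNL p a - powNL p b =
      ‖a‖ ^ (p - 1) • (a - b) + (‖a‖ ^ (p - 1) - ‖b‖ ^ (p - 1)) • b := by
    rw [powNL_eq_smul, powNL_eq_smul, smul_sub, sub_smul]
    abel
  have h2 : ‖b‖ ^ (p - 1) ≤ ‖a‖ ^ (p - 1) := Real.rpow_le_rpow (norm_nonneg _) h hp1
  have h3 : ∀ z : ℂ, ‖z‖ ^ (p - 1) * ‖z‖ = ‖z‖ ^ p := fun z => by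
    rw [← norm_powNL hp, powNL_eq_smul, norm_smul, Real.norm_of_nonneg (by positivity)]
  have h4 : ‖(‖a‖ ^ (p - 1) - ‖b‖ ^ (p - 1)) • b‖ ≤ p * ‖a‖ ^ (p - 1) * ‖a - b‖ := by
    rw [norm_smul, Real.norm_of_nonneg (sub_nonneg.2 h2)]
    calc (‖a‖ ^ (p - 1) - ‖b‖ ^ (p - 1)) * ‖b‖ ≤ ‖a‖ ^ (p - 1) * ‖a‖ - ‖b‖ ^ (p - 1) * ‖b‖ := by
          have : 0 ≤ ‖a‖ ^ (p - 1) := by positivity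
          nlinarith
      _ = ‖a‖ ^ p - ‖b‖ ^ p := by rw [h3, h3]
      _ ≤ p * ‖a‖ ^ (p - 1) * (‖a‖ - ‖b‖) := rpow_sub_rpow_le hp (norm_nonneg _) h
      _ ≤ p * ‖a‖ ^ (p - 1) * ‖a - b‖ := by
          refine mul_le_mul_of_nonneg_left (norm_sub_norm_le a b) ?_
          have : 0 < p := by linarith
          positivity
  have h5 : ‖a‖ ^ (p - 1) ≤ M ^ (p - 1) := Real.rpow_le_rpow (norm_nonneg _) ha hp1
  calc ‖powNL p a - powNL p b‖ ≤ ‖a‖ ^ (p - 1) * ‖a - b‖ + p * ‖a‖ ^ (p - 1) * ‖a - b‖ := by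
        rw [h1]
        refine (norm_add_le _ _).trans (add_le_add ?_ h4)
        rw [norm_smul, Real.norm_of_nonneg (by positivity)]
    _ = (1 + p) * ‖a‖ ^ (p - 1) * ‖a - b‖ := by ring
    _ ≤ (1 + p) * M ^ (p - 1) * ‖a - b‖ := by gcongr

theorem contDiffAt_powNL (p : ℝ) {z : ℂ} (hz : z ≠ 0) : ContDiffAt ℝ 1 (powNL p) z := by
  have h1 : ContDiffAt ℝ 1 (fun z : ℂ => ‖z‖ ^ (p - 1)) z :=
    (contDiffAt_norm ℝ hz).rpow_const_of_ne (norm_ne_zero_iff.2 hz)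
  have h2 : powNL p = fun z : ℂ => ‖z‖ ^ (p - 1) • z := funext (powNL_eq_smul p)
  rw [h2]
  exact h1.smul contDiffAt_id

/-- A derivative is bounded by a local Lipschitz constant; the strict inequality leaves a
neighbourhood of `z` inside the disc. -/
theorem norm_fderiv_powNL_le {p : ℝ} (hp : 1 < p) {M : ℝ} {z : ℂ} (hz : ‖z‖ < M) :
    ‖fderiv ℝ (powNL p) z‖ ≤ (1 + p) * M ^ (p - 1) := by
  have hM : 0 < M := (norm_nonneg z).trans_lt hz
  refine norm_fderiv_le_of_lip' ℝ (by have : 0 < p := by linarith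
                                      positivity) ?_
  have : ∀ᶠ y in 𝓝 z, ‖y‖ < M := (continuous_norm.tendsto z).eventually (gt_mem_nhds hz)
  filter_upwards [this] with y hy
  exact norm_powNL_sub_le hp hy.le hz.le

theorem hasFDerivAt_powNL_zero {p : ℝ} (hp : 1 < p) :
    HasFDerivAt (powNL p) (0 : ℂ →L[ℝ] ℂ) 0 := by
  rw [hasFDerivAt_iff_tendsto]
  have h1 : Tendsto (fun z : ℂ => ‖z‖ ^ (p - 1)) (𝓝 0) (𝓝 0) := by
    have : Continuous fun z : ℂ => ‖z‖ ^ (p - 1) :=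
      continuous_norm.rpow_const fun _ => Or.inr (by linarith)
    simpa [Real.zero_rpow (show p - 1 ≠ 0 by linarith)] using this.tendsto 0
  refine squeeze_zero (fun z => by positivity) (fun z => ?_) h1
  have h2 : powNL p 0 = 0 := by simp [powNL]
  rw [h2, sub_zero, sub_zero, zero_apply, sub_zero, powNL_eq_smul, norm_smul,
    Real.norm_of_nonneg (by positivity)]
  rcases eq_or_ne z 0 with rfl | hz
  · simp [Real.zero_rpow (show p - 1 ≠ 0 by linarith)]
  · have : ‖z‖ ≠ 0 := norm_ne_zero_iff.2 hz
    rw [mul_left_comm, inv_mul_cancel₀ this, mul_one]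

theorem differentiable_powNL {p : ℝ} (hp : 1 < p) : Differentiable ℝ (powNL p) := fun z => by
  rcases eq_or_ne z 0 with rfl | hz
  · exact (hasFDerivAt_powNL_zero hp).differentiableAt
  · exact (contDiffAt_powNL p hz).differentiableAt one_ne_zero

/-- Away from the origin the map is continuously differentiable; at the origin the Lipschitz bound
on the disc of radius `2‖z‖` forces the derivative to 0. For `p` close to 1 this is all the
regularity there is. -/
theorem continuous_fderiv_powNL {p : ℝ} (hp : 1 < p) : Continuous (fderiv ℝ (powNL p)) := by
  rw [continuous_iff_continuousAt]
  intro z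
  rcases eq_or_ne z 0 with rfl | hz
  · rw [ContinuousAt, (hasFDerivAt_powNL_zero hp).fderiv, tendsto_zero_iff_norm_tendsto_zero]
    have h1 : Tendsto (fun z : ℂ => (1 + p) * (2 * ‖z‖) ^ (p - 1)) (𝓝 0) (𝓝 0) := by
      have : Continuous fun z : ℂ => (1 + p) * (2 * ‖z‖) ^ (p - 1) :=
        continuous_const.mul ((continuous_const.mul continuous_norm).rpow_const
          fun _ => Or.inr (by linarith))
      simpa [Real.zero_rpow (show p - 1 ≠ 0 by linarith)] using this.tendsto 0
    refine squeeze_zero (fun z => norm_nonneg _) (fun z => ?_) h1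
    rcases eq_or_ne z 0 with rfl | hz
    · rw [(hasFDerivAt_powNL_zero hp).fderiv, norm_zero]
      have : 0 < p := by linarith
      positivity
    · exact norm_fderiv_powNL_le hp (by linarith [norm_pos_iff.2 hz])
  · exact (contDiffAt_powNL p hz).continuousAt_fderiv one_ne_zero

/-- Second differences of the nonlinearity. -/
theorem exists_delta_powNL_second_difference {p : ℝ} (hp : 1 < p) (M : ℝ) {ε : ℝ}
    (hε : 0 < ε) :
    ∃ δ > 0, ∀ a a' b b' : ℂ, ‖a‖ ≤ M → ‖a'‖ ≤ M → ‖b‖ ≤ M → ‖b'‖ ≤ M →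
      ‖a - b‖ ≤ δ → ‖a' - b'‖ ≤ δ →
      ‖(powNL p a' - powNL p b') - (powNL p a - powNL p b)‖ ≤
        (1 + p) * (M + 1) ^ (p - 1) * ‖(a' - b') - (a - b)‖ + ε * ‖b' - b‖ := by
  -- Uniform continuity of the derivative on the compact disc replaces a Lipschitz bound on it, so
  -- the last term carries `ε` instead of a multiple of `‖a - b‖`.
  have huc := (isCompact_closedBall (0 : ℂ) M).uniformContinuousOn_of_continuous
    (continuous_fderiv_powNL hp).continuousOn
  rw [Metric.uniformContinuousOn_iff_le] at huc
  obtain ⟨δ, hδ, H⟩ := huc ε hε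
  refine ⟨δ, hδ, fun a a' b b' ha ha' hb hb' hab hab' => ?_⟩
  have hconv : ∀ {R : ℝ} {x y : ℂ}, ‖x‖ ≤ R → ‖y‖ ≤ R → ∀ r ∈ Set.Icc (0 : ℝ) 1,
      ‖x + r • (y - x)‖ ≤ R := fun {R x y} hx hy r hr => by
    have := (convex_closedBall (0 : ℂ) R).add_smul_sub_mem (x := x) (y := y)
      (by simpa using hx) (by simpa using hy) hr
    simpa using this
  have hline : ∀ x y : ℂ, ∀ r : ℝ, HasDerivAt (fun r : ℝ => powNL p (x + r • (y - x)))
      (fderiv ℝ (powNL p) (x + r • (y - x)) (y - x)) r := fun x y r => by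
    have h1 : HasDerivAt (fun r : ℝ => x + r • (y - x)) (y - x) r := by
      simpa using ((hasDerivAt_id r).smul_const (y - x)).const_add x
    exact (differentiable_powNL hp _).hasFDerivAt.comp_hasDerivAt r h1
  have hd : ∀ r ∈ Set.Icc (0 : ℝ) 1, HasDerivWithinAt
      (fun r : ℝ => powNL p (a + r • (a' - a)) - powNL p (b + r • (b' - b)))
      (fderiv ℝ (powNL p) (a + r • (a' - a)) (a' - a) -
        fderiv ℝ (powNL p) (b + r • (b' - b)) (b' - b)) (Set.Icc 0 1) r :=
    fun r _ => ((hline a a' r).sub (hline b b' r)).hasDerivWithinAt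
  have h := norm_image_sub_le_of_norm_deriv_le_segment_01' hd
    (C := (1 + p) * (M + 1) ^ (p - 1) * ‖(a' - b') - (a - b)‖ + ε * ‖b' - b‖) fun r hr => ?_
  · simpa using h
  · have hr' : r ∈ Set.Icc (0 : ℝ) 1 := ⟨hr.1, hr.2.le⟩
    have hA := hconv ha ha' r hr'
    have hB := hconv hb hb' r hr'
    have hAB : ‖(a + r • (a' - a)) - (b + r • (b' - b))‖ ≤ δ := by
      have := hconv hab hab' r hr'
      convert this using 2
      simp only [smul_sub]
      abel
    -- Along the segments from `a` to `a'` and from `b` to `b'`, the derivative is regrouped into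
    -- the second difference of the arguments, plus the variation of the derivative of the
    -- nonlinearity applied to `b' - b`.
    have e1 : fderiv ℝ (powNL p) (a + r • (a' - a)) (a' - a) -
        fderiv ℝ (powNL p) (b + r • (b' - b)) (b' - b) =
        fderiv ℝ (powNL p) (a + r • (a' - a)) ((a' - b') - (a - b)) +
        (fderiv ℝ (powNL p) (a + r • (a' - a)) - fderiv ℝ (powNL p) (b + r • (b' - b)))
          (b' - b) := by
      rw [sub_apply]
      simp only [map_sub]
      abel
    rw [e1]
    refine (norm_add_le _ _).trans (add_le_add ?_ ?_)
    · refine (ContinuousLinearMap.le_opNorm _ _).trans ?_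
      gcongr
      exact norm_fderiv_powNL_le hp (by linarith)
    · refine (ContinuousLinearMap.le_opNorm _ _).trans ?_
      gcongr
      rw [← dist_eq_norm]
      exact H _ (by simpa using hA) _ (by simpa using hB) (by rwa [dist_eq_norm])

/-- The nonlinearity, cut off outside the disc of radius `M`. -/
def cutNL (p M : ℝ) (z : ℂ) : ℂ := powNL p (radialRetraction M z)

theorem cutNL_zero (p M : ℝ) : cutNL p M 0 = 0 := by simp [cutNL, powNL, radialRetraction]

theorem cutNL_of_norm_le (p : ℝ) {M : ℝ} {z : ℂ} (hz : ‖z‖ ≤ M) : cutNL p M z = powNL p z := by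
  rw [cutNL, radialRetraction_of_norm_le hz]

/-- A Lipschitz constant of `cutNL p M`. -/
def cutConst (p M : ℝ) : NNReal := ((1 + p) * M ^ (p - 1)).toNNReal * 2

theorem lipschitzWith_cutNL {p M : ℝ} (hp : 1 < p) (hM : 0 ≤ M) :
    LipschitzWith (cutConst p M) (cutNL p M) := by
  refine LipschitzWith.of_dist_le_mul fun a b => ?_
  have h1 := norm_powNL_sub_le hp (norm_radialRetraction_le hM a) (norm_radialRetraction_le hM b)
  have h2 := (lipschitzWith_radialRetraction (X := ℂ) hM).dist_le_mul a b
  rw [dist_eq_norm] at h2 ⊢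
  have h3 : 0 ≤ (1 + p) * M ^ (p - 1) := by
    have : 0 < p := by linarith
    positivity
  refine h1.trans ?_
  rw [cutConst, NNReal.coe_mul, Real.coe_toNNReal _ h3, mul_assoc _ ((2 : NNReal) : ℝ)]
  gcongr

/-- By Cauchy–Schwarz the inner product is at least the product in the hypothesis, so monotonicity
of a radial map reduces to that of its profile. -/
theorem inner_smul_sub_smul_nonneg {E : Type*} [NormedAddCommGroup E] [InnerProductSpace ℝ E]
    {x y : E} {r q : ℝ} (hr : 0 ≤ r) (hq : 0 ≤ q)
    (h : 0 ≤ (r * ‖x‖ - q * ‖y‖) * (‖x‖ - ‖y‖)) : 0 ≤ inner ℝ (x - y) (r • x - q • y) := by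
  have h1 : inner ℝ (x - y) (r • x - q • y) = r * ‖x‖ ^ 2 + q * ‖y‖ ^ 2 - (r + q) * inner ℝ x y := by
    simp only [inner_sub_left, inner_sub_right, inner_smul_right, real_inner_self_eq_norm_sq,
      real_inner_comm x y]
    ring
  have h2 := real_inner_le_norm x y
  rw [h1]
  nlinarith

/-- The cut-off map is radial with profile `min(|z|, M)^p`, still nondecreasing. Truncating the
argument radially is what preserves dissipativity. -/
theorem inner_cutNL_sub_nonneg {p M : ℝ} (hp : 1 < p) (hM : 0 ≤ M) (a b : ℂ) :
    0 ≤ inner ℝ (a - b) (cutNL p M a - cutNL p M b) := by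
  set ψ : ℂ → ℝ := fun z => ‖radialRetraction M z‖ ^ (p - 1) * radialFactor M z
  have h1 : ∀ z, cutNL p M z = ψ z • z := fun z => by
    rw [cutNL, powNL_eq_smul, mul_smul]
    rfl
  have hψ : ∀ z, 0 ≤ ψ z := fun z => mul_nonneg (by positivity) (radialFactor_nonneg hM z)
  have h2 : ∀ z, ψ z * ‖z‖ = (min ‖z‖ M) ^ p := fun z => by
    rw [← norm_radialRetraction hM, ← norm_powNL hp, ← cutNL, h1, norm_smul,
      Real.norm_of_nonneg (hψ z)]
  rw [h1, h1]
  refine inner_smul_sub_smul_nonneg (hψ a) (hψ b) ?_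
  rw [h2, h2]
  have hp0 : 0 ≤ p := by linarith
  rcases le_total ‖a‖ ‖b‖ with h | h
  · refine mul_nonneg_of_nonpos_of_nonpos (sub_nonpos.2 ?_) (sub_nonpos.2 h)
    gcongr
  · refine mul_nonneg (sub_nonneg.2 ?_) (sub_nonneg.2 h)
    gcongr

/-- The cut-off nonlinearity acting on `L²`. -/
def cutNLLp {p M : ℝ} (hp : 1 < p) (hM : 0 ≤ M) (f : L2) : L2 :=
  (lipschitzWith_cutNL hp hM).compLp (cutNL_zero p M) f

section CutNLLp

variable {p M : ℝ} (hp : 1 < p) (hM : 0 ≤ M)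

theorem coeFn_cutNLLp (f : L2) : cutNLLp hp hM f =ᵐ[volume] fun x => cutNL p M (f x) :=
  (lipschitzWith_cutNL hp hM).coeFn_compLp (cutNL_zero p M) f

theorem norm_cutNLLp_sub_le (f g : L2) :
    ‖cutNLLp hp hM f - cutNLLp hp hM g‖ ≤ cutConst p M * ‖f - g‖ :=
  (lipschitzWith_cutNL hp hM).norm_compLp_sub_le (cutNL_zero p M) f g

theorem cutNLLp_zero : cutNLLp hp hM 0 = 0 := by
  apply Lp.ext
  filter_upwards [coeFn_cutNLLp hp hM 0, Lp.coeFn_zero ℂ 2 (volume : Measure ℝ)] with x h1 h2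
  rw [h1, h2, Pi.zero_apply, cutNL_zero]

theorem continuous_cutNLLp : Continuous (cutNLLp hp hM) :=
  (LipschitzWith.of_dist_le_mul (K := cutConst p M) fun f g => by
    rw [dist_eq_norm, dist_eq_norm]
    exact norm_cutNLLp_sub_le hp hM f g).continuous

theorem inner_cutNLLp_sub_nonneg (f g : L2) :
    0 ≤ inner ℝ (f - g) (cutNLLp hp hM f - cutNLLp hp hM g) := by
  rw [L2.inner_def]
  refine integral_nonneg_of_ae ?_
  filter_upwards [Lp.coeFn_sub f g, Lp.coeFn_sub (cutNLLp hp hM f) (cutNLLp hp hM g),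
    coeFn_cutNLLp hp hM f, coeFn_cutNLLp hp hM g] with x h1 h2 h3 h4
  rw [h1, h2, Pi.sub_apply, Pi.sub_apply, h3, h4]
  exact inner_cutNL_sub_nonneg hp hM _ _

/-- Rescaling both arguments by the same nonnegative factor keeps monotonicity. This lets the
dissipation survive the truncation of a vector field by a radial retraction. -/
theorem inner_cutNLLp_smul_sub_nonneg {θ : ℝ} (hθ : 0 ≤ θ) (f g : L2) :
    0 ≤ inner ℝ (f - g) (cutNLLp hp hM (θ • f) - cutNLLp hp hM (θ • g)) := by
  rcases hθ.eq_or_lt with rfl | hθ'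
  · simp
  have h := inner_cutNLLp_sub_nonneg hp hM (θ • f) (θ • g)
  rw [← smul_sub, real_inner_smul_left] at h
  exact (mul_nonneg_iff_of_pos_left hθ').1 h

theorem translate_cutNLLp (h : ℝ) (f : L2) :
    translate h (cutNLLp hp hM f) = cutNLLp hp hM (translate h f) :=
  translate_compLp _ _ h f

end CutNLLp

/-! ### The equation in the interaction picture -/

/-- The symbol of `(-Δ)^{1/2}`. -/
def halfLaplacianSymbol : C(ℝ, ℝ) := ⟨fun ξ => |2 * Real.pi * ξ|, by fun_prop⟩

/-- The free propagator `exp(-i t (-Δ)^{1/2})`. -/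
abbrev propagator (t : ℝ) : L2 →ₗᵢ[ℂ] L2 := phaseFlow halfLaplacianSymbol (-t)

theorem propagator_neg_cancel (t : ℝ) (f : L2) : propagator (-t) (propagator t f) = f :=
  phaseFlow_neg_cancel _ _ f

theorem propagator_cancel_neg (t : ℝ) (f : L2) : propagator t (propagator (-t) f) = f :=
  phaseFlow_cancel_neg _ _ f

theorem propagator_zero (f : L2) : propagator 0 f = f := by simp [propagator]

theorem isometry_map_real_smul (P : L2 →ₗᵢ[ℂ] L2) (c : ℝ) (f : L2) : P (c • f) = c • P f := by
  rw [← L2_coe_smul, ← L2_coe_smul, map_smul]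

theorem inner_isometry_map (P : L2 →ₗᵢ[ℂ] L2) (f g : L2) :
    inner ℝ (P f) (P g) = inner ℝ f g := by
  rw [real_inner_eq_norm_add_mul_self_sub_norm_mul_self_sub_norm_mul_self_div_two,
    real_inner_eq_norm_add_mul_self_sub_norm_mul_self_sub_norm_mul_self_div_two, ← map_add,
    P.norm_map, P.norm_map, P.norm_map]

theorem hasDerivWithinAt_isometry_map (P : L2 →ₗᵢ[ℂ] L2) {w : ℝ → L2} {w' : L2} {S : Set ℝ}
    {t : ℝ} (hw : HasDerivWithinAt w w' S t) :
    HasDerivWithinAt (fun τ => P (w τ)) (P w') S t :=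
  (P.toContinuousLinearMap.restrictScalars ℝ).hasFDerivAt.comp_hasDerivWithinAt t hw

/-- `w` is the interaction-picture form `w(t) = exp(i t (-Δ)^{1/2}) u(t)` of a solution `u` of the
equation, with the nonlinearity cut off at height `M` and evaluated at `θ u`. -/
def IsInteractionCurve {p M : ℝ} (hp : 1 < p) (hM : 0 ≤ M) (T : ℝ) (θ : ℝ → ℝ) (w : ℝ → L2) :
    Prop :=
  ∀ t ∈ Set.Icc 0 T, HasDerivWithinAt w
    (-propagator (-t) (cutNLLp hp hM (θ t • propagator t (w t)))) (Set.Icc 0 T) t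

section Curves

variable {p M : ℝ} {hp : 1 < p} {hM : 0 ≤ M} {T : ℝ} {θ : ℝ → ℝ} {w z : ℝ → L2}

/-- The propagator is an isometry for the real inner product, so it can be moved off the
nonlinearity, and monotonicity makes the difference dissipative. Both curves must share the same
scalar function `θ`. -/
theorem IsInteractionCurve.norm_sub_le (hw : IsInteractionCurve hp hM T θ w)
    (hz : IsInteractionCurve hp hM T θ z) (hθ : ∀ t ∈ Set.Icc 0 T, 0 ≤ θ t) {t : ℝ}
    (ht : t ∈ Set.Icc 0 T) : ‖w t - z t‖ ≤ ‖w 0 - z 0‖ := by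
  refine norm_sub_le_of_dissipative hw hz (fun τ hτ => ?_) ht
  rw [← neg_sub', inner_neg_right, ← map_sub, ← inner_isometry_map (propagator τ), propagator_cancel_neg, map_sub]
  have := inner_cutNLLp_smul_sub_nonneg hp hM (hθ τ hτ) (propagator τ (w τ)) (propagator τ (z τ))
  linarith

theorem IsInteractionCurve.zero : IsInteractionCurve hp hM T θ fun _ => 0 := fun t _ => by
  simp only [map_zero, smul_zero, cutNLLp_zero, neg_zero]
  exact hasDerivWithinAt_const _ _ _

/-- Fourier multipliers commute with each other, and translations commute with the nonlinearity.
Even when `θ` comes from `w`, it enters as a fixed function of time and is the same for the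
translate. -/
theorem IsInteractionCurve.translate (hw : IsInteractionCurve hp hM T θ w) (h : ℝ) :
    IsInteractionCurve hp hM T θ fun t => translate h (w t) := fun t ht => by
  have h1 := hasDerivWithinAt_isometry_map (Semirelativistic.translate h) (hw t ht)
  rw [map_neg, phaseFlow_comm, translate_cutNLLp, isometry_map_real_smul, phaseFlow_comm] at h1
  exact h1

theorem IsInteractionCurve.norm_le (hw : IsInteractionCurve hp hM T θ w)
    (hθ : ∀ t ∈ Set.Icc 0 T, 0 ≤ θ t) {t : ℝ} (ht : t ∈ Set.Icc 0 T) : ‖w t‖ ≤ ‖w 0‖ := by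
  simpa using hw.norm_sub_le IsInteractionCurve.zero hθ ht

/-- The `L²` contraction for a curve and its own translate: the `H¹` a priori bound. -/
theorem IsInteractionCurve.translationBound (hw : IsInteractionCurve hp hM T θ w)
    (hθ : ∀ t ∈ Set.Icc 0 T, 0 ≤ θ t) {R : ℝ} (h0 : TranslationBound (w 0) R) {t : ℝ}
    (ht : t ∈ Set.Icc 0 T) : TranslationBound (w t) R := fun h =>
  ((hw.translate h).norm_sub_le hw hθ ht).trans (h0 h)

end Curves

theorem TranslationBound.phaseFlow {f : L2} {R : ℝ} (hf : TranslationBound f R) (ω : C(ℝ, ℝ))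
    (t : ℝ) : TranslationBound (phaseFlow ω t f) R := fun h => by
  rw [phaseFlow_comm, ← map_sub, LinearIsometry.norm_map]
  exact hf h

theorem TranslationBound.sub {f g : L2} {R R' : ℝ} (hf : TranslationBound f R)
    (hg : TranslationBound g R') : TranslationBound (f - g) (R + R') := fun h => by
  have e : translate h (f - g) - (f - g) = (translate h f - f) - (translate h g - g) := by
    rw [map_sub]
    abel
  rw [e, add_mul]
  exact (norm_sub_le _ _).trans (add_le_add (hf h) (hg h))

/-- A height at which a function in the `H¹` ball of radius `R` is not cut off. -/
def cutHeight (R : ℝ) : ℝ := 1 + 2 * R ^ 2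

theorem cutHeight_nonneg (R : ℝ) : 0 ≤ cutHeight R := by
  unfold cutHeight
  positivity

theorem TranslationBound.ae_norm_le_cutHeight {f : L2} {R : ℝ} (hf : TranslationBound f R)
    (hR : ‖f‖ ≤ R) : ∀ᵐ x, ‖f x‖ ≤ cutHeight R := by
  have hR0 : 0 ≤ R := (norm_nonneg f).trans hR
  -- With both parameters equal to 1 the bound is `1 + ‖f‖² + R²`, the origin of the formula for
  -- `cutHeight`.
  filter_upwards [hf.ae_norm_le hR0 one_pos one_pos] with x hx
  refine hx.trans ?_
  have : ‖f‖ ^ 2 ≤ R ^ 2 := by gcongr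
  rw [cutHeight]
  linarith

theorem Hs.ae_norm_le_cutHeight {s : ℝ} (hs : 1 ≤ s) (f : Hs s) {R : ℝ} (hR : ‖f‖ ≤ R) :
    ∀ᵐ x, ‖f.toL2 x‖ ≤ cutHeight R :=
  TranslationBound.ae_norm_le_cutHeight
    (fun h => (f.translationBound hs h).trans (by gcongr))
    ((f.norm_toL2_le (by linarith)).trans hR)

theorem cutNLLp_ae_eq_powNL {p M : ℝ} (hp : 1 < p) (hM : 0 ≤ M) {f : L2}
    (hf : ∀ᵐ x, ‖f x‖ ≤ M) : cutNLLp hp hM f =ᵐ[volume] fun x => powNL p (f x) := by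
  filter_upwards [coeFn_cutNLLp hp hM f, hf] with x h1 h2
  rw [h1, cutNL_of_norm_le p h2]

/-! ### Solutions and interaction-picture curves -/

theorem Hs.exists_isHalfLaplacian {s : ℝ} (hs : 1 ≤ s) (f : Hs s) :
    ∃ Df : L2, IsHalfLaplacian f.toL2 Df := by
  have hmem : MemLp (fun ξ : ℝ => ((|2 * Real.pi * ξ| : ℝ) : ℂ) * (𝓕 f.toL2 : L2) ξ) 2 volume := by
    refine f.memLp.of_le (Continuous.aestronglyMeasurable (by fun_prop) |>.mul
      (Lp.aestronglyMeasurable _)) (Eventually.of_forall fun ξ => ?_)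
    rw [norm_mul, norm_mul, Complex.norm_real, Complex.norm_real, norm_abs_eq_norm,
      Real.norm_of_nonneg (besselSymbol_pos s ξ).le]
    refine mul_le_mul_of_nonneg_right (le_trans ?_ (besselSymbol_mono hs ξ)) (norm_nonneg _)
    refine abs_le_of_sq_le_sq ?_ (besselSymbol_pos 1 ξ).le
    rw [besselSymbol_one_sq]
    linarith
  refine ⟨(Lp.fourierTransformₗᵢ ℝ ℂ).symm hmem.toLp, ?_⟩
  have hf : (𝓕 ((Lp.fourierTransformₗᵢ ℝ ℂ).symm hmem.toLp) : L2) = hmem.toLp :=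
    (Lp.fourierTransformₗᵢ ℝ ℂ).apply_symm_apply _
  rw [IsHalfLaplacian, hf]
  exact hmem.coeFn_toLp

theorem IsHalfLaplacian.phaseFlow {f Df : L2} (h : IsHalfLaplacian f Df) (ω : C(ℝ, ℝ)) (t : ℝ) :
    IsHalfLaplacian (phaseFlow ω t f) (phaseFlow ω t Df) := by
  rw [IsHalfLaplacian, fourier_phaseFlow, fourier_phaseFlow]
  filter_upwards [h, coeFn_phaseMul ω t (𝓕 f : L2), coeFn_phaseMul ω t (𝓕 Df : L2)] with ξ h1 h2 h3
  rw [h2, h3, h1]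
  ring

/-- The interaction-picture curve of a curve in `H^s`. -/
def interactionCurve {s T : ℝ} (hT : 0 ≤ T) (u : C(Set.Icc 0 T, Hs s)) (t : ℝ) : L2 :=
  propagator (-t) (Set.IccExtend hT u t).toL2

theorem interactionCurve_of_mem {s T : ℝ} (hT : 0 ≤ T) (u : C(Set.Icc 0 T, Hs s))
    (t : Set.Icc 0 T) : interactionCurve hT u t = propagator (-t) (u t).toL2 := by
  rw [interactionCurve, Set.IccExtend_val]

theorem IsSolution.interactionCurve_zero {p s T : ℝ} {hT : 0 ≤ T} {u₀ : Hs s}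
    {u : C(Set.Icc 0 T, Hs s)} (h : IsSolution p hT u₀ u) :
    interactionCurve hT u 0 = u₀.toL2 := by
  have := interactionCurve_of_mem hT u ⟨0, Set.left_mem_Icc.2 hT⟩
  rw [h.initial] at this
  simpa [propagator_zero] using this

/-- The product rule cancels the half Laplacian, and below height `M` the cut-off nonlinearity is
the true one. Estimates for interaction curves thus pass to arbitrary solutions. -/
theorem IsSolution.isInteractionCurve {p s T : ℝ} {hT : 0 ≤ T} {u₀ : Hs s}
    {u : C(Set.Icc 0 T, Hs s)} (h : IsSolution p hT u₀ u) (hp : 1 < p) {M : ℝ} (hM : 0 ≤ M)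
    (hu : ∀ t, ∀ᵐ x, ‖(u t).toL2 x‖ ≤ M) :
    IsInteractionCurve hp hM T (fun _ => 1) (interactionCurve hT u) := by
  intro t ht
  obtain ⟨ut, Du, hd, hD, he⟩ := h.equation ⟨t, ht⟩
  have hext : Set.IccExtend hT u t = u ⟨t, ht⟩ := Set.IccExtend_of_mem hT u ht
  have h1 := hasDerivWithinAt_phaseFlow_comp halfLaplacianSymbol 1 hd (Du := Du)
    (by rw [hext]; exact hD)
  have h2 : ut + ((1 : ℝ) * Complex.I : ℂ) • Du = -cutNLLp hp hM (u ⟨t, ht⟩).toL2 := by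
    apply Lp.ext
    filter_upwards [Lp.coeFn_add ut (((1 : ℝ) * Complex.I : ℂ) • Du),
      Lp.coeFn_smul ((1 : ℝ) * Complex.I : ℂ) Du, Lp.coeFn_neg (cutNLLp hp hM (u ⟨t, ht⟩).toL2),
      cutNLLp_ae_eq_powNL hp hM (hu ⟨t, ht⟩), he] with x e1 e2 e3 e4 e5
    rw [e1, e3, Pi.add_apply, Pi.neg_apply, e2, Pi.smul_apply, e4, smul_eq_mul, powNL]
    have e6 : Complex.I * (ut x + ((1 : ℝ) : ℂ) * Complex.I * Du x) =
        Complex.I * ut x - Du x := by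
      rw [Complex.ofReal_one]
      linear_combination (Du x) * Complex.I_mul_I
    refine mul_left_cancel₀ Complex.I_ne_zero ?_
    rw [e6, e5]
    ring
  rw [h2, one_mul, map_neg] at h1
  rw [one_smul, interactionCurve, propagator_cancel_neg, hext, propagator, neg_neg]
  refine h1.congr_of_eventuallyEq (Eventually.of_forall fun τ => ?_) ?_ <;>
  simp only [interactionCurve, propagator, neg_neg, one_mul]

/-- The product rule run backwards. It needs `u t` in the domain of the half Laplacian, which is
where `1 ≤ s` enters. -/
theorem isSolution_of_isInteractionCurve {p M s T : ℝ} {hT : 0 ≤ T} (hs : 1 ≤ s) {hp : 1 < p}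
    {hM : 0 ≤ M} {w : ℝ → L2} (hw : IsInteractionCurve hp hM T (fun _ => 1) w) {u₀ : Hs s}
    {u : C(Set.Icc 0 T, Hs s)} (huw : ∀ t : Set.Icc 0 T, (u t).toL2 = propagator t (w t))
    (h0 : w 0 = u₀.toL2) (hu : ∀ t, ∀ᵐ x, ‖(u t).toL2 x‖ ≤ M) : IsSolution p hT u₀ u := by
  refine ⟨Hs.toL2_injective ?_, fun t => ?_⟩
  · rw [huw, h0, propagator_zero]
  obtain ⟨Du, hDu⟩ := (u t).exists_isHalfLaplacian hs
  have hDw : IsHalfLaplacian (w t) (propagator (-t) Du) := by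
    have := hDu.phaseFlow halfLaplacianSymbol (- -t)
    rwa [huw, propagator_neg_cancel] at this
  have h1 := hasDerivWithinAt_phaseFlow_comp halfLaplacianSymbol (-1) (hw t t.2)
    (Du := propagator (-t) Du) hDw
  rw [neg_one_mul, one_smul, map_add, map_neg, propagator_cancel_neg, map_smul,
    propagator_cancel_neg, ← huw] at h1
  refine ⟨_, Du, h1.congr (fun τ hτ => ?_) ?_, hDu, ?_⟩
  · rw [Set.IccExtend_of_mem hT u hτ, huw, neg_one_mul]
  · rw [Set.IccExtend_val, huw, neg_one_mul]
  filter_upwards [Lp.coeFn_add (-cutNLLp hp hM (u t).toL2) (((-1 : ℝ) * Complex.I : ℂ) • Du),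
    Lp.coeFn_smul ((-1 : ℝ) * Complex.I : ℂ) Du, Lp.coeFn_neg (cutNLLp hp hM (u t).toL2),
    cutNLLp_ae_eq_powNL hp hM (hu t)] with x e1 e2 e3 e4
  rw [e1, Pi.add_apply, e2, e3, Pi.smul_apply, Pi.neg_apply, e4, smul_eq_mul, powNL]
  push_cast
  linear_combination -(Du x) * Complex.I_mul_I

theorem norm_toL2_sub_eq {s T : ℝ} (hT : 0 ≤ T) (u v : C(Set.Icc 0 T, Hs s))
    (t : Set.Icc 0 T) :
    ‖(u t).toL2 - (v t).toL2‖ = ‖interactionCurve hT u t - interactionCurve hT v t‖ := by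
  rw [interactionCurve_of_mem, interactionCurve_of_mem, ← map_sub (propagator (-t)),
    LinearIsometry.norm_map]

/-- The flow is a contraction in `L²`. -/
theorem IsSolution.norm_toL2_sub_le {p s T : ℝ} {hT : 0 ≤ T} (hp : 1 < p) (hs : 1 ≤ s)
    {u₀ v₀ : Hs s} {u v : C(Set.Icc 0 T, Hs s)} (hu : IsSolution p hT u₀ u)
    (hv : IsSolution p hT v₀ v) (t : Set.Icc 0 T) :
    ‖(u t).toL2 - (v t).toL2‖ ≤ ‖u₀.toL2 - v₀.toL2‖ := by
  -- Both solutions are bounded in `H^s` on the compact interval, so one height leaves both uncut.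
  have hM := cutHeight_nonneg (max ‖u‖ ‖v‖)
  have h1 := hu.isInteractionCurve hp hM fun t => (u t).ae_norm_le_cutHeight hs
    ((u.norm_coe_le_norm t).trans (le_max_left _ _))
  have h2 := hv.isInteractionCurve hp hM fun t => (v t).ae_norm_le_cutHeight hs
    ((v.norm_coe_le_norm t).trans (le_max_right _ _))
  have h3 := h1.norm_sub_le h2 (fun _ _ => zero_le_one) t.2
  rwa [hu.interactionCurve_zero, hv.interactionCurve_zero, ← norm_toL2_sub_eq] at h3

/-- Uniqueness holds among all solutions in `C([0,T]; H^s)`, so no smaller auxiliary space is needed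
for `Y`. -/
theorem IsSolution.eq {p s T : ℝ} {hT : 0 ≤ T} (hp : 1 < p) (hs : 1 ≤ s) {u₀ : Hs s}
    {u v : C(Set.Icc 0 T, Hs s)} (hu : IsSolution p hT u₀ u) (hv : IsSolution p hT u₀ v) :
    u = v := by
  ext1 t
  have h := hu.norm_toL2_sub_le hp hs hv t
  rw [sub_self, norm_zero, norm_le_zero_iff, sub_eq_zero] at h
  exact Hs.toL2_injective h

theorem IsSolution.norm_toL2_le {p s T : ℝ} {hT : 0 ≤ T} (hp : 1 < p) (hs : 1 ≤ s) {u₀ : Hs s}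
    {u : C(Set.Icc 0 T, Hs s)} (hu : IsSolution p hT u₀ u) (t : Set.Icc 0 T) :
    ‖(u t).toL2‖ ≤ ‖u₀.toL2‖ := by
  have h1 := hu.isInteractionCurve hp (cutHeight_nonneg ‖u‖) fun t =>
    (u t).ae_norm_le_cutHeight hs (u.norm_coe_le_norm t)
  have h2 := h1.norm_le (fun _ _ => zero_le_one) t.2
  rwa [hu.interactionCurve_zero, interactionCurve_of_mem, LinearIsometry.norm_map] at h2

theorem IsSolution.translationBound {p s T : ℝ} {hT : 0 ≤ T} (hp : 1 < p) (hs : 1 ≤ s)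
    {u₀ : Hs s} {u : C(Set.Icc 0 T, Hs s)} (hu : IsSolution p hT u₀ u) {R : ℝ}
    (hR : TranslationBound u₀.toL2 R) (t : Set.Icc 0 T) : TranslationBound (u t).toL2 R := by
  have h1 := hu.isInteractionCurve hp (cutHeight_nonneg ‖u‖) fun t =>
    (u t).ae_norm_le_cutHeight hs (u.norm_coe_le_norm t)
  have h2 := h1.translationBound (fun _ _ => zero_le_one) (R := R)
    (by rwa [hu.interactionCurve_zero]) t.2
  have h3 := h2.phaseFlow halfLaplacianSymbol (-t)
  rwa [interactionCurve_of_mem, propagator_cancel_neg] at h3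

/-! ### Well-posedness in `H¹` -/

theorem continuous_interaction_vectorField {p M : ℝ} (hp : 1 < p) (hM : 0 ≤ M) (x : L2) :
    Continuous fun t => -propagator (-t) (cutNLLp hp hM (propagator t x)) := by
  refine Continuous.neg (continuous_iff_continuousAt.2 fun t => ?_)
  have h1 : Continuous fun t => cutNLLp hp hM (propagator t x) :=
    (continuous_cutNLLp hp hM).comp ((continuous_phaseFlow _ x).comp continuous_neg)
  exact tendsto_isometry_family (phaseFlow halfLaplacianSymbol)
    (continuous_phaseFlow halfLaplacianSymbol) (continuous_neg.comp continuous_neg).continuousAt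
    h1.continuousAt

/-- The curve truncated at radius `‖w₀‖` is itself an interaction curve, with `θ` the truncation
factor. Its norm does not increase, so the truncation never acts. -/
theorem exists_isInteractionCurve {p M T : ℝ} (hp : 1 < p) (hM : 0 ≤ M) (hT : 0 ≤ T) (w₀ : L2) :
    ∃ w : ℝ → L2, w 0 = w₀ ∧ IsInteractionCurve hp hM T (fun _ => 1) w := by
  obtain ⟨w, hw0, hw⟩ := exists_truncated_integralCurve hT (norm_nonneg w₀)
    (fun t x => -propagator (-t) (cutNLLp hp hM (propagator t x))) (K := cutConst p M)
    (fun t x y _ _ => by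
      rw [neg_sub_neg, ← map_sub, LinearIsometry.norm_map, norm_sub_rev x y,
        ← (propagator t).norm_map (y - x), map_sub]
      exact norm_cutNLLp_sub_le hp hM _ _)
    (continuous_interaction_vectorField hp hM)
    (fun t => by rw [map_zero, cutNLLp_zero, map_zero, neg_zero]) w₀
  have h1 : IsInteractionCurve hp hM T (fun t => radialFactor ‖w₀‖ (w t)) w := fun t ht => by
    have := hw t ht
    rwa [radialRetraction, isometry_map_real_smul] at this
  refine ⟨w, hw0, fun t ht => ?_⟩
  have h2 : ‖w t‖ ≤ ‖w₀‖ := by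
    rw [← hw0]
    exact h1.norm_le (fun τ _ => radialFactor_nonneg (norm_nonneg _) _) ht
  have h3 := hw t ht
  rw [radialRetraction_of_norm_le h2] at h3
  simpa only [one_smul] using h3

/-- The curve of the cut-off equation in `L²` inherits the translation bound of the datum. It
therefore lies in `H¹` and stays below the cut-off height. What remains is continuity in time for
the `H¹` norm. -/
theorem exists_isSolution_H1 {p T : ℝ} (hp : 1 < p) (hT : 0 ≤ T) (u₀ : Hs 1) :
    ∃ u : C(Set.Icc 0 T, Hs 1), IsSolution p hT u₀ u := by
  set R : ℝ := ‖u₀‖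
  have hR : 0 ≤ R := norm_nonneg _
  have hM : 0 ≤ cutHeight R := cutHeight_nonneg R
  obtain ⟨w, hw0, hw⟩ := exists_isInteractionCurve hp hM hT u₀.toL2
  have htb : ∀ t ∈ Set.Icc 0 T, TranslationBound (w t) R := fun t ht =>
    hw.translationBound (fun _ _ => zero_le_one) (hw0 ▸ u₀.translationBound le_rfl) ht
  have hnorm : ∀ t ∈ Set.Icc 0 T, ‖w t‖ ≤ R := fun t ht =>
    (hw.norm_le (fun _ _ => zero_le_one) ht).trans
      (hw0 ▸ u₀.norm_toL2_le zero_le_one)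
  choose g hg _ using fun t : Set.Icc 0 T => (htb t t.2).exists_Hs hR
  set K : ℝ := ((cutConst p (cutHeight R) : NNReal) : ℝ)
  have hK : 0 ≤ K := NNReal.coe_nonneg _
  have hder : ∀ h : ℝ, ∀ t ∈ Set.Icc 0 T, HasDerivWithinAt (fun τ => translate h (w τ) - w τ)
      (-propagator (-t) (cutNLLp hp hM (propagator t (translate h (w t)))) -
        -propagator (-t) (cutNLLp hp hM (propagator t (w t)))) (Set.Icc 0 T) t := fun h t ht => by
    have := (hw.translate h t ht).sub (hw t ht)
    simpa only [one_smul] using! this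
  have hlip : ∀ t t' : Set.Icc 0 T, ‖w t' - w t‖ ≤ K * R * ‖(t' : ℝ) - t‖ := fun t t' => by
    refine norm_sub_le_of_norm_deriv_le_Icc hw (fun τ hτ => ?_) t.2 t'.2
    rw [norm_neg, LinearIsometry.norm_map, one_smul]
    have := norm_cutNLLp_sub_le hp hM (propagator τ (w τ)) 0
    rw [cutNLLp_zero, sub_zero, sub_zero, LinearIsometry.norm_map] at this
    exact this.trans (mul_le_mul_of_nonneg_left (hnorm τ hτ) hK)
  -- The translation increment of `w` has a time derivative of norm at most `K R |h|`, by the `L²`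
  -- Lipschitz bound on the nonlinearity. Integrated in time, this bounds the translation increments
  -- of `w t' - w t`, that is, its derivative in `x`.
  have hlipT : ∀ t t' : Set.Icc 0 T,
      TranslationBound (w t' - w t) (K * R * ‖(t' : ℝ) - t‖) := fun t t' h => by
    have e : translate h (w t' - w t) - (w t' - w t) =
        (translate h (w t') - w t') - (translate h (w t) - w t) := by
      rw [map_sub]
      abel
    rw [e]
    refine (norm_sub_le_of_norm_deriv_le_Icc (hder h) (C := K * R * |h|) (fun τ hτ => ?_)
      t.2 t'.2).trans_eq (by ring)
    rw [neg_sub_neg, ← map_sub, LinearIsometry.norm_map, norm_sub_rev]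
    refine (norm_cutNLLp_sub_le hp hM _ _).trans ?_
    rw [← map_sub, LinearIsometry.norm_map, mul_assoc]
    exact mul_le_mul_of_nonneg_left (htb τ hτ h) hK
  have hgl : ∀ t t' : Set.Icc 0 T, ‖g t' - g t‖ ≤ 2 * (K * R * ‖(t' : ℝ) - t‖) := fun t t' => by
    have h0 : 0 ≤ K * R * ‖(t' : ℝ) - t‖ := by positivity
    obtain ⟨k, hk, hkn⟩ := (hlipT t t').exists_Hs h0
    have hkg : k = g t' - g t := Hs.toL2_injective (by rw [hk, map_sub, hg, hg])
    rw [← hkg]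
    have h1 := hlip t t'
    have h2 : ‖w t' - w t‖ ^ 2 ≤ (K * R * ‖(t' : ℝ) - t‖) ^ 2 := by gcongr
    refine le_of_sq_le_sq ?_ (by positivity)
    nlinarith [sq_nonneg (K * R * ‖(t' : ℝ) - t‖)]
  have hgc : Continuous g := by
    refine (LipschitzWith.of_dist_le_mul (K := (2 * (K * R)).toNNReal) fun t t' => ?_).continuous
    rw [dist_eq_norm, Real.coe_toNNReal _ (by positivity), Subtype.dist_eq, dist_eq_norm]
    exact (hgl t' t).trans_eq (by ring)
  set u : C(Set.Icc 0 T, Hs 1) :=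
    ⟨fun t => Hs.phaseFlow zero_le_one halfLaplacianSymbol (-t) (g t), by
      refine continuous_iff_continuousAt.2 fun t => ?_
      exact tendsto_isometry_family _ (Hs.continuous_phaseFlow zero_le_one halfLaplacianSymbol)
        continuous_subtype_val.neg.continuousAt hgc.continuousAt⟩
  have huw : ∀ t : Set.Icc 0 T, (u t).toL2 = propagator t (w t) := fun t => by
    rw [← hg t]
    exact Hs.toL2_phaseFlow _ _ _ _
  refine ⟨u, isSolution_of_isInteractionCurve le_rfl hw huw hw0 fun t => ?_⟩
  rw [huw]
  exact ((htb t t.2).phaseFlow _ _).ae_norm_le_cutHeight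
    (by rw [LinearIsometry.norm_map]; exact hnorm t t.2)

/-! ### Continuous dependence on the data in `H¹` -/

theorem L2_norm_le_of_ae_le {f g k : L2} {a b : ℝ} (ha : 0 ≤ a) (hb : 0 ≤ b)
    (h : ∀ᵐ x, ‖f x‖ ≤ a * ‖g x‖ + b * ‖k x‖) : ‖f‖ ≤ a * ‖g‖ + b * ‖k‖ := by
  have hg := (Lp.memLp g).norm
  have hk := (Lp.memLp k).norm
  have h1 : ‖f‖ ≤ ‖a • hg.toLp + b • hk.toLp‖ := by
    refine Lp.norm_le_norm_of_ae_le ?_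
    filter_upwards [h, Lp.coeFn_add (a • hg.toLp) (b • hk.toLp), Lp.coeFn_smul a hg.toLp,
      Lp.coeFn_smul b hk.toLp, hg.coeFn_toLp, hk.coeFn_toLp] with x e1 e2 e3 e4 e5 e6
    rw [e2, Pi.add_apply, e3, e4, Pi.smul_apply, Pi.smul_apply, e5, e6, smul_eq_mul, smul_eq_mul]
    exact e1.trans (le_abs_self _)
  have h2 : ‖hg.toLp‖ = ‖g‖ := by rw [Lp.norm_toLp, eLpNorm_norm, Lp.norm_def]
  have h3 : ‖hk.toLp‖ = ‖k‖ := by rw [Lp.norm_toLp, eLpNorm_norm, Lp.norm_def]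
  refine h1.trans ((norm_add_le _ _).trans ?_)
  rw [norm_smul, norm_smul, h2, h3, Real.norm_of_nonneg ha, Real.norm_of_nonneg hb]

/-- Translation increments of the difference of two values of the nonlinearity. -/
theorem exists_delta_translate_cutNLLp {p M : ℝ} (hp : 1 < p) (hM : 0 ≤ M) {ε : ℝ} (hε : 0 < ε) :
    ∃ δ > 0, ∀ f g : L2, (∀ᵐ x, ‖f x‖ ≤ M) → (∀ᵐ x, ‖g x‖ ≤ M) → (∀ᵐ x, ‖(f - g) x‖ ≤ δ) →
      ∀ h, ‖translate h (cutNLLp hp hM f - cutNLLp hp hM g) -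
        (cutNLLp hp hM f - cutNLLp hp hM g)‖ ≤
        (1 + p) * (M + 1) ^ (p - 1) * ‖translate h (f - g) - (f - g)‖ +
          ε * ‖translate h g - g‖ := by
  obtain ⟨δ, hδ, H⟩ := exists_delta_powNL_second_difference hp M hε
  refine ⟨δ, hδ, fun f g hf hg hfg h => ?_⟩
  have hmp : MeasurePreserving (fun x : ℝ => x + h) volume volume :=
    measurePreserving_add_right volume h
  have hp0 : 0 < p := by linarith
  refine L2_norm_le_of_ae_le (by positivity) hε.le ?_
  have hall : ∀ᵐ x, ‖f x‖ ≤ M ∧ ‖g x‖ ≤ M ∧ ‖f x - g x‖ ≤ δ ∧ (f - g) x = f x - g x ∧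
      (cutNLLp hp hM f - cutNLLp hp hM g) x = powNL p (f x) - powNL p (g x) := by
    filter_upwards [hf, hg, hfg, Lp.coeFn_sub f g, cutNLLp_ae_eq_powNL hp hM hf,
      cutNLLp_ae_eq_powNL hp hM hg, Lp.coeFn_sub (cutNLLp hp hM f) (cutNLLp hp hM g)]
      with x e1 e2 e3 e4 e5 e6 e7
    rw [e4] at e3
    exact ⟨e1, e2, e3, e4, by rw [e7, Pi.sub_apply, e5, e6]⟩
  filter_upwards [hall, hmp.quasiMeasurePreserving.ae hall,
    coeFn_translate h (cutNLLp hp hM f - cutNLLp hp hM g), coeFn_translate h (f - g),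
    coeFn_translate h g,
    Lp.coeFn_sub (translate h (cutNLLp hp hM f - cutNLLp hp hM g))
      (cutNLLp hp hM f - cutNLLp hp hM g),
    Lp.coeFn_sub (translate h (f - g)) (f - g), Lp.coeFn_sub (translate h g) g]
    with x ⟨a1, a2, a3, a4, a5⟩ ⟨b1, b2, b3, b4, b5⟩ c1 c2 c3 d1 d2 d3
  rw [d1, d2, d3, Pi.sub_apply, Pi.sub_apply, Pi.sub_apply, c1, c2, c3, a4, a5, b4, b5]
  exact H _ _ _ _ a1 b1 a2 b2 a3 b3

/-- Continuous dependence on the data, uniformly on bounded sets of `H¹`. -/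
theorem exists_delta_H1 {p T : ℝ} (hp : 1 < p) (hT : 0 ≤ T) {R : ℝ} (hR : 0 ≤ R) {ε : ℝ}
    (hε : 0 < ε) :
    ∃ δ > 0, ∀ (u₀ v₀ : Hs 1) (u v : C(Set.Icc 0 T, Hs 1)), IsSolution p hT u₀ u →
      IsSolution p hT v₀ v → ‖u₀‖ ≤ R → ‖v₀‖ ≤ R → ‖v₀ - u₀‖ ≤ δ → ‖v - u‖ ≤ ε := by
  have hM : 0 ≤ cutHeight R := cutHeight_nonneg R
  have hp0 : 0 < p := by linarith
  set L : ℝ := (1 + p) * (cutHeight R + 1) ^ (p - 1)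
  have hL : 0 ≤ L := by positivity
  set E : ℝ := Real.exp (L * T)
  have hE : 0 < E := Real.exp_pos _
  -- This makes the total forcing `ε' R T` times the Gronwall factor `E` at most `ε/4`; the added 1
  -- keeps the denominator positive.
  set ε' : ℝ := ε / (4 * E * (R * T + 1))
  have hε' : 0 < ε' := by positivity
  -- The tolerance `ε'` fixes the required uniform closeness `δ₁`, which in turn fixes the `L²`
  -- closeness `δ₂`. The latter persists in time because the flow contracts in `L²`.
  obtain ⟨δ₁, hδ₁, H₁⟩ := exists_delta_translate_cutNLLp hp hM hε'
  obtain ⟨δ₂, hδ₂, H₂⟩ := exists_delta_ae_norm_le (R := R + R) (by linarith) hδ₁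
  refine ⟨min δ₂ (min (ε / 2) (ε / (4 * E))), by positivity, ?_⟩
  intro u₀ v₀ u v hu hv hu₀ hv₀ hδ
  have hδa : ‖v₀ - u₀‖ ≤ δ₂ := hδ.trans (min_le_left _ _)
  have hδb : ‖v₀ - u₀‖ ≤ ε / 2 := hδ.trans ((min_le_right _ _).trans (min_le_left _ _))
  have hδc : ‖v₀ - u₀‖ ≤ ε / (4 * E) := hδ.trans ((min_le_right _ _).trans (min_le_right _ _))
  have hTB : ∀ {y₀ : Hs 1} {y : C(Set.Icc 0 T, Hs 1)}, IsSolution p hT y₀ y → ‖y₀‖ ≤ R →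
      ∀ t, TranslationBound (y t).toL2 R := fun {y₀ y} hy hy₀ t =>
    hy.translationBound hp le_rfl (fun h => (y₀.translationBound le_rfl h).trans (by gcongr)) t
  have hsup : ∀ {y₀ : Hs 1} {y : C(Set.Icc 0 T, Hs 1)}, IsSolution p hT y₀ y → ‖y₀‖ ≤ R →
      ∀ t, ∀ᵐ x, ‖(y t).toL2 x‖ ≤ cutHeight R := fun {y₀ y} hy hy₀ t =>
    (hTB hy hy₀ t).ae_norm_le_cutHeight (((hy.norm_toL2_le hp le_rfl t).trans
      (y₀.norm_toL2_le zero_le_one)).trans hy₀)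
  have hd0 : ∀ t, ‖(v t).toL2 - (u t).toL2‖ ≤ ‖v₀ - u₀‖ := fun t => by
    refine (hv.norm_toL2_sub_le hp le_rfl hu t).trans ?_
    rw [← map_sub]
    exact (v₀ - u₀).norm_toL2_le zero_le_one
  have hclose : ∀ t, ∀ᵐ x, ‖((v t).toL2 - (u t).toL2) x‖ ≤ δ₁ := fun t =>
    H₂ _ ((hTB hv hv₀ t).sub (hTB hu hu₀ t)) ((hd0 t).trans hδa)
  have hcu := hu.isInteractionCurve hp hM (hsup hu hu₀)
  have hcv := hv.isInteractionCurve hp hM (hsup hv hv₀)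
  set w := interactionCurve hT u
  set z := interactionCurve hT v
  have hwt : ∀ t : Set.Icc 0 T, propagator t (w t) = (u t).toL2 := fun t => by
    simp only [w, interactionCurve_of_mem, propagator_cancel_neg]
  have hzt : ∀ t : Set.Icc 0 T, propagator t (z t) = (v t).toL2 := fun t => by
    simp only [z, interactionCurve_of_mem, propagator_cancel_neg]
  -- Gronwall for the translation increment of `z - w` at each fixed `h`. Initial size and forcing
  -- are both proportional to `|h|`, so the outcome is a translation bound.
  have key : ∀ t : Set.Icc 0 T, TranslationBound ((v t).toL2 - (u t).toL2) (ε / 2) := by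
    intro t
    rw [← hwt t, ← hzt t, ← map_sub]
    refine TranslationBound.phaseFlow (fun h => ?_) _ _
    have hder : ∀ τ ∈ Set.Icc 0 T, HasDerivWithinAt
        (fun τ => translate h (z τ - w τ) - (z τ - w τ))
        (translate h (-propagator (-τ) (cutNLLp hp hM ((1 : ℝ) • propagator τ (z τ))) -
          -propagator (-τ) (cutNLLp hp hM ((1 : ℝ) • propagator τ (w τ)))) -
          (-propagator (-τ) (cutNLLp hp hM ((1 : ℝ) • propagator τ (z τ))) -
          -propagator (-τ) (cutNLLp hp hM ((1 : ℝ) • propagator τ (w τ))))) (Set.Icc 0 T) τ := by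
      intro τ hτ
      have h1 := (hcv τ hτ).sub (hcu τ hτ)
      exact (hasDerivWithinAt_isometry_map (translate h) h1).sub h1
    have hbd := norm_le_mul_exp_of_norm_deriv_le (K := L) (ε := ε' * (R * |h|))
      (δ := ‖v₀ - u₀‖ * |h|) hL (by positivity) (by positivity) hder ?_ (fun τ hτ => ?_) t.2
    · refine hbd.trans ?_
      have e1 : ‖v₀ - u₀‖ * E ≤ ε / 4 := by
        calc ‖v₀ - u₀‖ * E ≤ ε / (4 * E) * E := by gcongr
          _ = ε / 4 := by field_simp
      have e2 : ε' * (R * T) * E ≤ ε / 4 := by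
        calc ε' * (R * T) * E ≤ ε' * (R * T + 1) * E := by gcongr; linarith
          _ = ε / 4 := by simp only [ε']; field_simp
      have e3 : (‖v₀ - u₀‖ * |h| + ε' * (R * |h|) * T) * E =
          (‖v₀ - u₀‖ * E + ε' * (R * T) * E) * |h| := by ring
      rw [e3]
      gcongr
      linarith
    · have h1 : z 0 - w 0 = (v₀ - u₀).toL2 := by
        rw [map_sub]
        simp only [z, w, hu.interactionCurve_zero, hv.interactionCurve_zero]
      rw [h1]
      exact (v₀ - u₀).translationBound le_rfl h
    · have e1 := H₁ _ _ (hsup hv hv₀ ⟨τ, hτ⟩) (hsup hu hu₀ ⟨τ, hτ⟩) (hclose ⟨τ, hτ⟩) h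
      have e2 : ∀ f g : L2, ‖translate h (-propagator (-τ) f - -propagator (-τ) g) -
          (-propagator (-τ) f - -propagator (-τ) g)‖ = ‖translate h (f - g) - (f - g)‖ := by
        intro f g
        rw [neg_sub_neg, ← map_sub, phaseFlow_comm, ← map_sub, LinearIsometry.norm_map,
          ← norm_neg, neg_sub', ← map_neg, neg_sub]
      have e3 : ‖translate h (z τ - w τ) - (z τ - w τ)‖ =
          ‖translate h ((v ⟨τ, hτ⟩).toL2 - (u ⟨τ, hτ⟩).toL2) -
            ((v ⟨τ, hτ⟩).toL2 - (u ⟨τ, hτ⟩).toL2)‖ := by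
        rw [← hwt ⟨τ, hτ⟩, ← hzt ⟨τ, hτ⟩, ← map_sub, phaseFlow_comm, ← map_sub,
          LinearIsometry.norm_map]
      rw [e2, one_smul, one_smul, e3, hwt ⟨τ, hτ⟩, hzt ⟨τ, hτ⟩]
      refine e1.trans (add_le_add le_rfl ?_)
      exact mul_le_mul_of_nonneg_left (hTB hu hu₀ _ h) hε'.le
  rw [ContinuousMap.norm_le _ hε.le]
  intro t
  obtain ⟨k, hk, hkn⟩ := (key t).exists_Hs (by linarith)
  have hkg : k = (v - u) t := Hs.toL2_injective (by rw [hk, ContinuousMap.sub_apply, map_sub])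
  rw [← hkg]
  have h2 : ‖(v t).toL2 - (u t).toL2‖ ^ 2 ≤ (ε / 2) ^ 2 := by
    have := (hd0 t).trans hδb
    gcongr
  refine le_of_sq_le_sq ?_ hε.le
  nlinarith

/-- Well-posedness with `Y = C([0,T]; H^s)`. -/
theorem wellPosedOn_of_continuous_dependence {p s T : ℝ} (hp : 1 < p) (hs : 1 ≤ s) (hT : 0 ≤ T)
    (hex : ∀ u₀ : Hs s, ∃ u : C(Set.Icc 0 T, Hs s), IsSolution p hT u₀ u)
    (hdep : ∀ R : ℝ, 0 ≤ R → ∀ ε > 0, ∃ δ > 0, ∀ (u₀ v₀ : Hs s) (u v : C(Set.Icc 0 T, Hs s)),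
      IsSolution p hT u₀ u → IsSolution p hT v₀ v → ‖u₀‖ ≤ R → ‖v₀‖ ≤ R → ‖v₀ - u₀‖ ≤ δ →
      ‖v - u‖ ≤ ε) : WellPosedOn p s hT := by
  have := Hs.completeSpace (s := s) (by linarith)
  refine ⟨C(Set.Icc 0 T, Hs s), inferInstance, inferInstance, inferInstance,
    ContinuousLinearMap.id ℂ _, Function.injective_id, fun u₀ => ?_, ?_⟩
  · obtain ⟨u, hu⟩ := hex u₀
    exact ⟨u, hu, fun v hv => IsSolution.eq hp hs hv hu⟩
  · intro u₀ u v₀ v hu hv hlim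
    rw [Metric.tendsto_nhds]
    intro ε hε
    -- The ball of radius `‖u₀‖ + 1` contains all data of the sequence that are within 1 of the
    -- limit.
    obtain ⟨δ, hδ, H⟩ := hdep (‖u₀‖ + 1) (by positivity) (ε / 2) (by positivity)
    filter_upwards [hlim.eventually (gt_mem_nhds (lt_min hδ one_pos))] with n hn
    have h1 : ‖v₀ n‖ ≤ ‖u₀‖ + 1 := by
      have h2 := norm_sub_norm_le (v₀ n) u₀
      have h3 := hn.trans_le (min_le_right _ _)
      linarith
    have h4 := H u₀ (v₀ n) u (v n) hu (hv n) (by linarith) h1 (hn.trans_le (min_le_left _ _)).le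
    rw [dist_zero_right, norm_norm]
    linarith

theorem globallyWellPosed_H1 {p : ℝ} (hp : 1 < p) : GloballyWellPosed p 1 := fun _ hT =>
  wellPosedOn_of_continuous_dependence hp le_rfl hT.le (exists_isSolution_H1 hp hT.le)
    fun _ hR _ hε => exists_delta_H1 hp hT.le hR hε

/-! ### Products in `H^s` -/

/-- Cauchy–Schwarz for the factorisation of `a b` into `√a` and `√a b`. -/
theorem sq_lintegral_mul_le {α : Type*} [MeasurableSpace α] (μ : Measure α) {a b : α → ENNReal}
    (ha : Measurable a) (hb : Measurable b) :
    (∫⁻ x, a x * b x ∂μ) ^ 2 ≤ (∫⁻ x, a x ∂μ) * ∫⁻ x, a x * b x ^ 2 ∂μ := by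
  have hhalf : ∀ x : ENNReal, x ^ (1 / 2 : ℝ) * x ^ (1 / 2 : ℝ) = x := fun x => by
    rw [← ENNReal.rpow_add_of_nonneg _ _ (by norm_num) (by norm_num)]
    norm_num
  have hsq : ∀ x : ENNReal, (x ^ (1 / 2 : ℝ)) ^ 2 = x := fun x => by rw [sq, hhalf]
  have h := ENNReal.lintegral_mul_le_Lp_mul_Lq μ Real.HolderConjugate.two_two
    (f := fun x => a x ^ (1 / 2 : ℝ)) (g := fun x => a x ^ (1 / 2 : ℝ) * b x)
    (ha.pow_const _).aemeasurable ((ha.pow_const _).mul hb).aemeasurable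
  have e1 : (fun x => a x ^ (1 / 2 : ℝ)) * (fun x => a x ^ (1 / 2 : ℝ) * b x) =
      fun x => a x * b x := by
    ext x
    rw [Pi.mul_apply, ← mul_assoc, hhalf]
  rw [e1] at h
  simp only [ENNReal.rpow_two, mul_pow, hsq] at h
  refine (pow_le_pow_left₀ zero_le h 2).trans_eq ?_
  rw [mul_pow, hsq, hsq]

theorem lintegral_const_mul_add (c : ENNReal) {a b : ℝ → ENNReal} (ha : Measurable a)
    (hb : Measurable b) : ∫⁻ x, c * (a x + b x) = c * ((∫⁻ x, a x) + ∫⁻ x, b x) := by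
  rw [← lintegral_add_left ha]
  exact lintegral_const_mul c (ha.add hb)

theorem lintegral_conv {a b : ℝ → ENNReal} (ha : Measurable a) (hb : Measurable b) :
    ∫⁻ ξ, ∫⁻ η, a η * b (ξ - η) = (∫⁻ η, a η) * ∫⁻ η, b η := by
  rw [lintegral_lintegral_swap]
  · have : ∀ η, ∫⁻ ξ, a η * b (ξ - η) = a η * ∫⁻ ξ, b ξ := fun η => by
      rw [lintegral_const_mul _ (show Measurable fun ξ => b (ξ - η) from
        hb.comp (measurable_id.sub_const η)), lintegral_sub_right_eq_self b η]
    simp_rw [this]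
    rw [lintegral_mul_const _ ha]
  · exact ((ha.comp measurable_snd).mul
      (hb.comp (measurable_fst.sub measurable_snd))).aemeasurable

/-- Young's inequality for the convolution of an integrable and a square-integrable function. -/
theorem lintegral_conv_sq_le {a b : ℝ → ENNReal} (ha : Measurable a) (hb : Measurable b) :
    ∫⁻ ξ, (∫⁻ η, a η * b (ξ - η)) ^ 2 ≤ (∫⁻ η, a η) ^ 2 * ∫⁻ η, b η ^ 2 := by
  calc ∫⁻ ξ, (∫⁻ η, a η * b (ξ - η)) ^ 2
      ≤ ∫⁻ ξ, (∫⁻ η, a η) * ∫⁻ η, a η * b (ξ - η) ^ 2 :=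
        lintegral_mono fun ξ =>
          sq_lintegral_mul_le volume ha (hb.comp (measurable_const.sub measurable_id))
    _ = (∫⁻ η, a η) * ∫⁻ ξ, ∫⁻ η, a η * b (ξ - η) ^ 2 := by
        refine lintegral_const_mul _ (Measurable.lintegral_prod_right' (f := fun q : ℝ × ℝ =>
          a q.2 * b (q.1 - q.2) ^ 2) ?_)
        exact (ha.comp measurable_snd).mul
          ((hb.comp (measurable_fst.sub measurable_snd)).pow_const 2)
    _ = (∫⁻ η, a η) ^ 2 * ∫⁻ η, b η ^ 2 := by
        rw [lintegral_conv ha (hb.pow_const 2), ← mul_assoc, sq]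

theorem lintegral_conv_swap (a b : ℝ → ENNReal) (ξ : ℝ) :
    ∫⁻ η, a η * b (ξ - η) = ∫⁻ η, b η * a (ξ - η) := by
  rw [← lintegral_sub_left_eq_self _ ξ]
  simp only [sub_sub_cancel, mul_comm]

/-- The larger of the frequencies `η` and `ξ - η` controls their sum `ξ`, so in a convolution the
weight falls on one factor at a time. -/
theorem besselSymbol_le_add {s : ℝ} (hs : 0 ≤ s) (ξ η : ℝ) :
    besselSymbol s ξ ≤ 4 ^ (s / 2) * (besselSymbol s η + besselSymbol s (ξ - η)) := by
  have hs2 : 0 ≤ s / 2 := by linarith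
  set x := 2 * Real.pi * η with hx
  set y := 2 * Real.pi * (ξ - η) with hy
  have hxy : 2 * Real.pi * ξ = x + y := by rw [hx, hy]; ring
  have h1 : 1 + (2 * Real.pi * ξ) ^ 2 ≤ 4 * max (1 + x ^ 2) (1 + y ^ 2) := by
    rw [hxy]
    have := le_max_left (1 + x ^ 2) (1 + y ^ 2)
    have := le_max_right (1 + x ^ 2) (1 + y ^ 2)
    nlinarith [sq_nonneg (x - y)]
  have hm : 0 ≤ max (1 + x ^ 2) (1 + y ^ 2) := le_max_of_le_left (by positivity)
  calc besselSymbol s ξ ≤ (4 * max (1 + x ^ 2) (1 + y ^ 2)) ^ (s / 2) :=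
        Real.rpow_le_rpow (by positivity) h1 hs2
    _ = 4 ^ (s / 2) * (max (1 + x ^ 2) (1 + y ^ 2)) ^ (s / 2) :=
        Real.mul_rpow (by norm_num) hm
    _ ≤ 4 ^ (s / 2) * (besselSymbol s η + besselSymbol s (ξ - η)) := by
        refine mul_le_mul_of_nonneg_left ?_ (by positivity)
        have h2 := (besselSymbol_pos s η).le
        have h3 := (besselSymbol_pos s (ξ - η)).le
        rcases max_choice (1 + x ^ 2) (1 + y ^ 2) with h | h <;> rw [h]
        · exact le_add_of_nonneg_right h3
        · exact le_add_of_nonneg_left h2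

/-- The `L¹` norm of the Fourier transform. -/
def fourierL1 (f : L2) : ℝ := ∫ ξ, ‖(𝓕 f : L2) ξ‖

theorem fourierL1_nonneg (f : L2) : 0 ≤ fourierL1 f := integral_nonneg fun _ => norm_nonneg _

theorem Hs.integrable_fourier {s : ℝ} (hs : 1 ≤ s) (f : Hs s) : Integrable (𝓕 f.toL2 : L2) :=
  ((f.translationBound hs).integral_fourier_le (norm_nonneg f) one_pos one_pos).1

/-- Taking `a = 1` and `μ = ‖f‖` makes the integrability bound homogeneous; since `μ` must be
positive, the zero function is treated apart. -/
theorem Hs.fourierL1_le {s : ℝ} (hs : 1 ≤ s) (f : Hs s) : fourierL1 f.toL2 ≤ 3 * ‖f‖ := by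
  rcases eq_or_ne f 0 with rfl | hf
  · have h0 : (𝓕 (Hs.toL2 (0 : Hs s)) : L2) = 0 := by
      rw [map_zero]
      exact (Lp.fourierTransformₗᵢ ℝ ℂ).map_zero
    have : fourierL1 (Hs.toL2 (0 : Hs s)) = 0 := by
      rw [fourierL1, h0]
      refine integral_eq_zero_of_ae ?_
      filter_upwards [Lp.coeFn_zero ℂ 2 (volume : Measure ℝ)] with ξ hξ
      simp
    rw [this]
    positivity
  have hpos : 0 < ‖f‖ := norm_pos_iff.2 hf
  refine ((f.translationBound hs).integral_fourier_le hpos.le one_pos hpos).2.trans ?_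
  have h1 : ‖f.toL2‖ ^ 2 ≤ ‖f‖ ^ 2 := by
    have := f.norm_toL2_le (by linarith)
    gcongr
  have h2 : (1 ^ 2 * ‖f.toL2‖ ^ 2 + ‖f‖ ^ 2) / ‖f‖ ≤ 2 * ‖f‖ := by
    rw [div_le_iff₀ hpos]
    nlinarith
  linarith

theorem ofReal_fourierL1 {f : L2} (hf : Integrable (𝓕 f : L2)) :
    ENNReal.ofReal (fourierL1 f) = ∫⁻ ξ, ‖(𝓕 f : L2) ξ‖ₑ :=
  ofReal_integral_norm_eq_lintegral_enorm hf

theorem enorm_besselSymbol (s ξ : ℝ) :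
    ‖(besselSymbol s ξ : ℂ)‖ₑ = ENNReal.ofReal (besselSymbol s ξ) := by
  rw [← ofReal_norm, Complex.norm_real, Real.norm_of_nonneg (besselSymbol_pos s ξ).le]

theorem Hs.ofReal_norm_sq {s : ℝ} (f : Hs s) : ENNReal.ofReal (‖f‖ ^ 2) =
    ∫⁻ ξ, (ENNReal.ofReal (besselSymbol s ξ) * ‖(𝓕 f.toL2 : L2) ξ‖ₑ) ^ 2 := by
  rw [Hs.norm_eq, L2_norm_sq, ofReal_integral_eq_lintegral_ofReal (L2_integrable_norm_sq _)
    (Eventually.of_forall fun _ => by positivity)]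
  refine lintegral_congr_ae ?_
  filter_upwards [f.coeFn_weightedFourier] with ξ hξ
  rw [hξ, ENNReal.ofReal_pow (norm_nonneg _), norm_mul, ENNReal.ofReal_mul (norm_nonneg _),
    ofReal_norm, ofReal_norm, enorm_besselSymbol]

/-- A function in `H^s` with a prescribed integrable Fourier transform. -/
theorem Hs.exists_of_fourier {s : ℝ} (hs : 0 ≤ s) {k : ℝ → ℂ} (hk : Integrable k) {B : ℝ}
    (hB0 : 0 ≤ B) (hB : ∫⁻ ξ, (ENNReal.ofReal (besselSymbol s ξ) * ‖k ξ‖ₑ) ^ 2 ≤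
      ENNReal.ofReal (B ^ 2)) :
    ∃ f : Hs s, f.toL2 =ᵐ[volume] 𝓕⁻ k ∧ (𝓕 f.toL2 : L2) =ᵐ[volume] k ∧ ‖f‖ ≤ B := by
  have hfin : ∀ g : ℝ → ℂ, AEStronglyMeasurable g volume → ∫⁻ ξ, ‖g ξ‖ₑ ^ 2 < ⊤ →
      MemLp g 2 volume := fun g hg hlt => by
    refine ⟨hg, ?_⟩
    rw [eLpNorm_lt_top_iff_lintegral_rpow_enorm_lt_top (by norm_num) (by norm_num)]
    simpa using hlt
  have hwm : AEStronglyMeasurable (fun ξ => (besselSymbol s ξ : ℂ) * k ξ) volume :=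
    (Complex.continuous_ofReal.comp (continuous_besselSymbol s)).aestronglyMeasurable.mul hk.1
  have hw : MemLp (fun ξ => (besselSymbol s ξ : ℂ) * k ξ) 2 volume := by
    refine hfin _ hwm (lt_of_le_of_lt (le_of_eq ?_) (hB.trans_lt ENNReal.ofReal_lt_top))
    refine lintegral_congr fun ξ => ?_
    rw [enorm_mul, enorm_besselSymbol]
  have hk2 : MemLp k 2 volume := by
    refine hw.of_le hk.1 (Eventually.of_forall fun ξ => ?_)
    rw [norm_mul, Complex.norm_real, Real.norm_of_nonneg (besselSymbol_pos s ξ).le]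
    exact le_mul_of_one_le_left (norm_nonneg _) (one_le_besselSymbol hs ξ)
  set g : L2 := (Lp.fourierTransformₗᵢ ℝ ℂ).symm hk2.toLp
  have hg : (𝓕 g : L2) = hk2.toLp := (Lp.fourierTransformₗᵢ ℝ ℂ).apply_symm_apply _
  have hgk : (𝓕 g : L2) =ᵐ[volume] k := by
    rw [hg]
    exact hk2.coeFn_toLp
  have hmem : g ∈ sobolevSubmodule s := by
    refine hw.ae_eq ?_
    filter_upwards [hgk] with ξ hξ
    rw [hξ]
  obtain ⟨f, hf⟩ := Hs.exists_toL2_eq hmem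
  refine ⟨f, ?_, by rwa [hf], ?_⟩
  · rw [hf]
    refine (ae_eq_fourierInv g (hk.congr hgk.symm)).trans (Eventually.of_forall fun x => ?_)
    exact Real.fourierInv_congr_ae hgk x
  · refine le_of_sq_le_sq ?_ hB0
    rw [← ENNReal.ofReal_le_ofReal_iff (by positivity), Hs.ofReal_norm_sq, hf]
    refine le_trans (le_of_eq (lintegral_congr_ae ?_)) hB
    filter_upwards [hgk] with ξ hξ
    rw [hξ]

theorem Hs.ae_eq_fourierInv {s : ℝ} (hs : 1 ≤ s) (f : Hs s) :
    f.toL2 =ᵐ[volume] 𝓕⁻ ((𝓕 f.toL2 : L2) : ℝ → ℂ) :=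
  Semirelativistic.ae_eq_fourierInv _ (f.integrable_fourier hs)

theorem measurable_enorm_L2 (f : L2) : Measurable fun ξ => ‖f ξ‖ₑ :=
  (Lp.stronglyMeasurable f).enorm

/-- The constant in the product estimate in `H^s`. -/
def productConst (s : ℝ) : ℝ := 2 * 4 ^ (s / 2)

theorem productConst_pos (s : ℝ) : 0 < productConst s := by
  unfold productConst
  positivity

/-- `H^s` is an algebra, with a tame product estimate. -/
theorem Hs.exists_mul {s : ℝ} (hs : 1 ≤ s) (f g : Hs s) :
    ∃ k : Hs s, (∀ᵐ x, k.toL2 x = f.toL2 x * g.toL2 x) ∧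
      fourierL1 k.toL2 ≤ fourierL1 f.toL2 * fourierL1 g.toL2 ∧
      ‖k‖ ≤ productConst s * (fourierL1 f.toL2 * ‖g‖ + fourierL1 g.toL2 * ‖f‖) := by
  have hs0 : 0 ≤ s := by linarith
  set F : ℝ → ℂ := ((𝓕 f.toL2 : L2) : ℝ → ℂ) with hF
  set G : ℝ → ℂ := ((𝓕 g.toL2 : L2) : ℝ → ℂ) with hG
  have hFi : Integrable F := f.integrable_fourier hs
  have hGi : Integrable G := g.integrable_fourier hs
  set K : ℝ → ℂ := convolution F G (ContinuousLinearMap.mul ℂ ℂ) volume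
  have hKi : Integrable K := hFi.integrable_convolution _ hGi
  have hFm : Measurable fun ξ => ‖F ξ‖ₑ := measurable_enorm_L2 _
  have hGm : Measurable fun ξ => ‖G ξ‖ₑ := measurable_enorm_L2 _
  have hbm : Measurable fun ξ => ENNReal.ofReal (besselSymbol s ξ) :=
    (continuous_besselSymbol s).measurable.ennreal_ofReal
  have hKle : ∀ ξ, ‖K ξ‖ₑ ≤ ∫⁻ η, ‖F η‖ₑ * ‖G (ξ - η)‖ₑ := fun ξ => by
    refine (enorm_integral_le_lintegral_enorm _).trans_eq (lintegral_congr fun η => ?_)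
    rw [ContinuousLinearMap.mul_apply', enorm_mul]
  set a : ℝ → ENNReal := fun ξ => ENNReal.ofReal (besselSymbol s ξ) * ‖F ξ‖ₑ
  set b : ℝ → ENNReal := fun ξ => ENNReal.ofReal (besselSymbol s ξ) * ‖G ξ‖ₑ
  have ham : Measurable a := hbm.mul hFm
  have hb'm : Measurable b := hbm.mul hGm
  set c : ENNReal := ENNReal.ofReal (4 ^ (s / 2))
  -- In each convolution the unweighted factor is placed first: Young's inequality measures it in
  -- `L¹` and the weighted one in `L²`, which makes the estimate tame.
  have hpt : ∀ ξ, ENNReal.ofReal (besselSymbol s ξ) * ‖K ξ‖ₑ ≤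
      c * ((∫⁻ η, ‖G η‖ₑ * a (ξ - η)) + ∫⁻ η, ‖F η‖ₑ * b (ξ - η)) := fun ξ => by
    have hsub : Measurable fun η : ℝ => ξ - η := measurable_const.sub measurable_id
    calc ENNReal.ofReal (besselSymbol s ξ) * ‖K ξ‖ₑ
        ≤ ENNReal.ofReal (besselSymbol s ξ) * ∫⁻ η, ‖F η‖ₑ * ‖G (ξ - η)‖ₑ := by
          gcongr
          exact hKle ξ
      _ = ∫⁻ η, ENNReal.ofReal (besselSymbol s ξ) * (‖F η‖ₑ * ‖G (ξ - η)‖ₑ) :=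
          (lintegral_const_mul _ (hFm.mul (hGm.comp hsub))).symm
      _ ≤ ∫⁻ η, c * (a η * ‖G (ξ - η)‖ₑ + ‖F η‖ₑ * b (ξ - η)) := by
          refine lintegral_mono fun η => ?_
          have h1 : ENNReal.ofReal (besselSymbol s ξ) ≤ c * (ENNReal.ofReal (besselSymbol s η) +
              ENNReal.ofReal (besselSymbol s (ξ - η))) := by
            rw [← ENNReal.ofReal_add (besselSymbol_pos _ _).le (besselSymbol_pos _ _).le,
              ← ENNReal.ofReal_mul (by positivity)]
            exact ENNReal.ofReal_le_ofReal (besselSymbol_le_add hs0 ξ η)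
          calc _ ≤ c * (ENNReal.ofReal (besselSymbol s η) +
              ENNReal.ofReal (besselSymbol s (ξ - η))) * (‖F η‖ₑ * ‖G (ξ - η)‖ₑ) := by gcongr
            _ = _ := by simp only [a, b]; ring
      _ = c * ((∫⁻ η, a η * ‖G (ξ - η)‖ₑ) + ∫⁻ η, ‖F η‖ₑ * b (ξ - η)) := by
          exact lintegral_const_mul_add c (ham.mul (hGm.comp hsub)) (hFm.mul (hb'm.comp hsub))
      _ = _ := by rw [lintegral_conv_swap a fun ξ => ‖G ξ‖ₑ]
  set α := fourierL1 f.toL2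
  set β := fourierL1 g.toL2
  have hα : 0 ≤ α := fourierL1_nonneg _
  have hβ : 0 ≤ β := fourierL1_nonneg _
  have hαe : ENNReal.ofReal α = ∫⁻ ξ, ‖F ξ‖ₑ := ofReal_fourierL1 hFi
  have hβe : ENNReal.ofReal β = ∫⁻ ξ, ‖G ξ‖ₑ := ofReal_fourierL1 hGi
  set B : ℝ := productConst s * (α * ‖g‖ + β * ‖f‖)
  have hB0 : 0 ≤ B := mul_nonneg (productConst_pos s).le (by positivity)
  have hsq : ∫⁻ ξ, (ENNReal.ofReal (besselSymbol s ξ) * ‖K ξ‖ₑ) ^ 2 ≤ ENNReal.ofReal (B ^ 2) := by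
    have hm1 : Measurable fun ξ => ∫⁻ η, ‖G η‖ₑ * a (ξ - η) :=
      Measurable.lintegral_prod_right' (f := fun q : ℝ × ℝ => ‖G q.2‖ₑ * a (q.1 - q.2))
        ((hGm.comp measurable_snd).mul (ham.comp (measurable_fst.sub measurable_snd)))
    have hm2 : Measurable fun ξ => ∫⁻ η, ‖F η‖ₑ * b (ξ - η) :=
      Measurable.lintegral_prod_right' (f := fun q : ℝ × ℝ => ‖F q.2‖ₑ * b (q.1 - q.2))
        ((hFm.comp measurable_snd).mul (hb'm.comp (measurable_fst.sub measurable_snd)))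
    have htwo : ∀ x y : ENNReal, (x + y) ^ 2 ≤ 4 * (x ^ 2 + y ^ 2) := fun x y => by
      rcases le_total x y with h | h
      · calc (x + y) ^ 2 ≤ (y + y) ^ 2 := by gcongr
          _ = 4 * y ^ 2 := by ring
          _ ≤ _ := by gcongr; exact le_add_self
      · calc (x + y) ^ 2 ≤ (x + x) ^ 2 := by gcongr
          _ = 4 * x ^ 2 := by ring
          _ ≤ _ := by gcongr; exact le_self_add
    calc ∫⁻ ξ, (ENNReal.ofReal (besselSymbol s ξ) * ‖K ξ‖ₑ) ^ 2
        ≤ ∫⁻ ξ, c ^ 2 * 4 * ((∫⁻ η, ‖G η‖ₑ * a (ξ - η)) ^ 2 +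
            (∫⁻ η, ‖F η‖ₑ * b (ξ - η)) ^ 2) := by
          refine lintegral_mono fun ξ => (pow_le_pow_left₀ zero_le (hpt ξ) 2).trans ?_
          rw [mul_pow, mul_assoc]
          gcongr
          exact htwo _ _
      _ = c ^ 2 * 4 * ((∫⁻ ξ, (∫⁻ η, ‖G η‖ₑ * a (ξ - η)) ^ 2) +
            ∫⁻ ξ, (∫⁻ η, ‖F η‖ₑ * b (ξ - η)) ^ 2) := by
          exact lintegral_const_mul_add _ (hm1.pow_const 2) (hm2.pow_const 2)
      _ ≤ c ^ 2 * 4 * (ENNReal.ofReal β ^ 2 * ENNReal.ofReal (‖f‖ ^ 2) +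
            ENNReal.ofReal α ^ 2 * ENNReal.ofReal (‖g‖ ^ 2)) := by
          rw [hαe, hβe, Hs.ofReal_norm_sq, Hs.ofReal_norm_sq]
          gcongr
          · exact lintegral_conv_sq_le hGm ham
          · exact lintegral_conv_sq_le hFm hb'm
      _ = ENNReal.ofReal ((4 ^ (s / 2)) ^ 2 * 4 * (β ^ 2 * ‖f‖ ^ 2 + α ^ 2 * ‖g‖ ^ 2)) := by
          rw [← ENNReal.ofReal_pow hα, ← ENNReal.ofReal_pow hβ,
            ← ENNReal.ofReal_pow (by positivity), ← ENNReal.ofReal_mul (by positivity),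
            ← ENNReal.ofReal_mul (by positivity), ← ENNReal.ofReal_add (by positivity)
            (by positivity), ENNReal.ofReal_mul (by positivity), ENNReal.ofReal_mul (by positivity)]
          norm_num
      _ ≤ ENNReal.ofReal (B ^ 2) := by
          refine ENNReal.ofReal_le_ofReal ?_
          have h1 : B ^ 2 = (4 ^ (s / 2)) ^ 2 * 4 * (α * ‖g‖ + β * ‖f‖) ^ 2 := by
            simp only [B, productConst]
            ring
          rw [h1]
          have h2 : 0 ≤ α * ‖g‖ * (β * ‖f‖) := by positivity
          gcongr
          nlinarith
  obtain ⟨k, hk1, hk2, hk3⟩ := Hs.exists_of_fourier hs0 hKi hB0 hsq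
  refine ⟨k, ?_, ?_, hk3⟩
  · filter_upwards [hk1, f.ae_eq_fourierInv hs, g.ae_eq_fourierInv hs] with x h1 h2 h3
    rw [h1, h2, h3, Real.fourierInv_eq_fourier_neg, Real.fourierInv_eq_fourier_neg,
      Real.fourierInv_eq_fourier_neg]
    exact Real.fourier_mul_convolution_eq hFi hGi (-x)
  · rw [← ENNReal.ofReal_le_ofReal_iff (by positivity), ofReal_fourierL1 (k.integrable_fourier hs),
      ENNReal.ofReal_mul hα, hαe, hβe, ← lintegral_conv hFm hGm]
    refine (le_of_eq (lintegral_congr_ae ?_)).trans (lintegral_mono hKle)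
    filter_upwards [hk2] with ξ hξ
    rw [hξ]

/-- Conjugation reflects and conjugates the Fourier transform, and the Bessel weight is even. -/
theorem Hs.exists_conj {s : ℝ} (hs : 1 ≤ s) (f : Hs s) :
    ∃ k : Hs s, (∀ᵐ x, k.toL2 x = starRingEnd ℂ (f.toL2 x)) ∧
      fourierL1 k.toL2 = fourierL1 f.toL2 ∧ ‖k‖ ≤ ‖f‖ := by
  have hs0 : 0 ≤ s := by linarith
  set F : ℝ → ℂ := ((𝓕 f.toL2 : L2) : ℝ → ℂ) with hF
  have hFi : Integrable F := f.integrable_fourier hs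
  set K : ℝ → ℂ := fun ξ => starRingEnd ℂ (F (-ξ)) with hK
  have hKi : Integrable K :=
    (LinearIsometryEquiv.integrable_comp_iff (Complex.conjLIE)).2 hFi.comp_neg
  have hKn : ∀ ξ, ‖K ξ‖ₑ = ‖F (-ξ)‖ₑ := fun ξ => by
    simp only [hK, RCLike.enorm_conj]
  have hb : ∀ ξ, besselSymbol s ξ = besselSymbol s (-ξ) := fun ξ => by
    simp only [besselSymbol]
    ring_nf
  have hsq : ∫⁻ ξ, (ENNReal.ofReal (besselSymbol s ξ) * ‖K ξ‖ₑ) ^ 2 = ENNReal.ofReal (‖f‖ ^ 2) := by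
    rw [Hs.ofReal_norm_sq, ← lintegral_neg_eq_self]
    refine lintegral_congr fun ξ => ?_
    rw [hKn, neg_neg, ← hb]
  obtain ⟨k, hk1, hk2, hk3⟩ := Hs.exists_of_fourier hs0 hKi (norm_nonneg f) hsq.le
  refine ⟨k, ?_, ?_, hk3⟩
  · filter_upwards [hk1, f.ae_eq_fourierInv hs] with x h1 h2
    rw [h1, h2, Real.fourierInv_eq', Real.fourierInv_eq', ← integral_conj,
      ← integral_neg_eq_self]
    refine integral_congr_ae (Eventually.of_forall fun v => ?_)
    simp only [hK, smul_eq_mul, map_mul, neg_neg, ← Complex.exp_conj, Complex.conj_ofReal,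
      Complex.conj_I, inner_neg_left]
    congr 2
    push_cast
    ring
  · have h1 : fourierL1 k.toL2 = ∫ ξ, ‖K ξ‖ := by
      refine integral_congr_ae ?_
      filter_upwards [hk2] with ξ hξ
      rw [hξ]
    rw [h1, fourierL1, ← integral_neg_eq_self]
    refine integral_congr_ae (Eventually.of_forall fun ξ => ?_)
    simp [hK, hF]

/-! ### The cubic equation in `H^s` -/

theorem one_le_productConst {s : ℝ} (hs : 0 ≤ s) : 1 ≤ productConst s := by
  have : (1 : ℝ) ≤ 4 ^ (s / 2) := Real.one_le_rpow (by norm_num) (by linarith)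
  rw [productConst]
  linarith

/-- In every term only one factor carries the `H^s` norm. On the diagonal the cubic term therefore
grows linearly in that norm once the Fourier `L¹` norm is controlled. -/
theorem Hs.exists_trilinear {s : ℝ} (hs : 1 ≤ s) (f g h : Hs s) :
    ∃ k : Hs s, (∀ᵐ x, k.toL2 x = f.toL2 x * starRingEnd ℂ (g.toL2 x) * h.toL2 x) ∧
      ‖k‖ ≤ productConst s ^ 2 * (fourierL1 f.toL2 * fourierL1 g.toL2 * ‖h‖ +
        fourierL1 f.toL2 * fourierL1 h.toL2 * ‖g‖ + fourierL1 g.toL2 * fourierL1 h.toL2 * ‖f‖) := by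
  obtain ⟨gc, hg1, hg2, hg3⟩ := g.exists_conj hs
  obtain ⟨m, hm1, hm2, hm3⟩ := f.exists_mul hs gc
  obtain ⟨k, hk1, -, hk3⟩ := m.exists_mul hs h
  refine ⟨k, ?_, hk3.trans ?_⟩
  · filter_upwards [hg1, hm1, hk1] with x e1 e2 e3
    rw [e3, e2, e1]
  rw [hg2] at hm2 hm3
  have hP := one_le_productConst (show 0 ≤ s by linarith)
  set P := productConst s
  set α := fourierL1 f.toL2
  set β := fourierL1 g.toL2
  set γ := fourierL1 h.toL2
  have hα : 0 ≤ α := fourierL1_nonneg _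
  have hβ : 0 ≤ β := fourierL1_nonneg _
  have hγ : 0 ≤ γ := fourierL1_nonneg _
  have hP0 : 0 ≤ P := by linarith
  have h1 : ‖m‖ ≤ P * (α * ‖g‖ + β * ‖f‖) := hm3.trans (by gcongr)
  calc P * (fourierL1 m.toL2 * ‖h‖ + γ * ‖m‖)
      ≤ P * (P * (α * β * ‖h‖) + γ * (P * (α * ‖g‖ + β * ‖f‖))) := by
        refine mul_le_mul_of_nonneg_left (add_le_add ?_ (mul_le_mul_of_nonneg_left h1 hγ)) hP0
        have h2 : α * β * ‖h‖ ≤ P * (α * β * ‖h‖) :=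
          le_mul_of_one_le_left (by positivity) hP
        exact (mul_le_mul_of_nonneg_right hm2 (norm_nonneg _)).trans h2
    _ = _ := by ring

theorem Hs.exists_trilinear_norm {s : ℝ} (hs : 1 ≤ s) (f g h : Hs s) :
    ∃ k : Hs s, (∀ᵐ x, k.toL2 x = f.toL2 x * starRingEnd ℂ (g.toL2 x) * h.toL2 x) ∧
      ‖k‖ ≤ 27 * productConst s ^ 2 * (‖f‖ * ‖g‖ * ‖h‖) := by
  obtain ⟨k, hk1, hk2⟩ := Hs.exists_trilinear hs f g h
  refine ⟨k, hk1, hk2.trans ?_⟩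
  have hα := fourierL1_nonneg f.toL2
  have hβ := fourierL1_nonneg g.toL2
  have hγ := fourierL1_nonneg h.toL2
  have e1 := f.fourierL1_le hs
  have e2 := g.fourierL1_le hs
  have e3 := h.fourierL1_le hs
  calc _ ≤ productConst s ^ 2 * ((3 * ‖f‖) * (3 * ‖g‖) * ‖h‖ + (3 * ‖f‖) * (3 * ‖h‖) * ‖g‖ +
        (3 * ‖g‖) * (3 * ‖h‖) * ‖f‖) := by gcongr
    _ = _ := by ring

/-- The cubic nonlinearity `|u|² u` on `H^s`. -/
def Hs.cubic {s : ℝ} (hs : 1 ≤ s) (u : Hs s) : Hs s := (Hs.exists_trilinear hs u u u).choose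

theorem Hs.coeFn_cubic {s : ℝ} (hs : 1 ≤ s) (u : Hs s) :
    ∀ᵐ x, (u.cubic hs).toL2 x = u.toL2 x * starRingEnd ℂ (u.toL2 x) * u.toL2 x :=
  (Hs.exists_trilinear hs u u u).choose_spec.1

theorem Hs.norm_cubic_le {s : ℝ} (hs : 1 ≤ s) (u : Hs s) :
    ‖u.cubic hs‖ ≤ 3 * productConst s ^ 2 * fourierL1 u.toL2 ^ 2 * ‖u‖ :=
  (Hs.exists_trilinear hs u u u).choose_spec.2.trans_eq (by ring)

theorem powNL_three (z : ℂ) : powNL 3 z = z * starRingEnd ℂ z * z := by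
  rw [powNL, Complex.mul_conj, Complex.normSq_eq_norm_sq]
  norm_num

theorem Hs.toL2_cubic {s : ℝ} (hs : 1 ≤ s) (u : Hs s) {M : ℝ} (hM : 0 ≤ M)
    (hp : (1 : ℝ) < 3) (hu : ∀ᵐ x, ‖u.toL2 x‖ ≤ M) :
    (u.cubic hs).toL2 = cutNLLp hp hM u.toL2 := by
  apply Lp.ext
  filter_upwards [u.coeFn_cubic hs, cutNLLp_ae_eq_powNL hp hM hu] with x e1 e2
  rw [e1, e2, powNL_three]

/-- The difference telescopes into three trilinear terms, each with `u - v` in one slot; `81 = 3 ·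
27`. -/
theorem Hs.norm_cubic_sub_le {s : ℝ} (hs : 1 ≤ s) {R : ℝ} {u v : Hs s}
    (hu : ‖u‖ ≤ R) (hv : ‖v‖ ≤ R) :
    ‖u.cubic hs - v.cubic hs‖ ≤ 81 * productConst s ^ 2 * R ^ 2 * ‖u - v‖ := by
  obtain ⟨k₁, h1, n1⟩ := Hs.exists_trilinear_norm hs (u - v) u u
  obtain ⟨k₂, h2, n2⟩ := Hs.exists_trilinear_norm hs v (u - v) u
  obtain ⟨k₃, h3, n3⟩ := Hs.exists_trilinear_norm hs v v (u - v)
  have hR : 0 ≤ R := (norm_nonneg u).trans hu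
  have heq : u.cubic hs - v.cubic hs = k₁ + k₂ + k₃ := by
    apply Hs.toL2_injective
    rw [map_sub, map_add, map_add]
    rw [map_sub] at h1 h2 h3
    apply Lp.ext
    filter_upwards [u.coeFn_cubic hs, v.coeFn_cubic hs, h1, h2, h3,
      Lp.coeFn_sub (u.cubic hs).toL2 (v.cubic hs).toL2, Lp.coeFn_add (k₁.toL2 + k₂.toL2) k₃.toL2,
      Lp.coeFn_add k₁.toL2 k₂.toL2, Lp.coeFn_sub u.toL2 v.toL2] with x a1 a2 a3 a4 a5 b1 b2 b3 b4
    rw [b1, b2, Pi.sub_apply, Pi.add_apply, b3, Pi.add_apply, a1, a2, a3, a4, a5, b4,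
      Pi.sub_apply, map_sub]
    ring
  rw [heq]
  have m1 : ‖k₁‖ ≤ 27 * productConst s ^ 2 * (‖u - v‖ * R * R) := n1.trans (by gcongr)
  have m2 : ‖k₂‖ ≤ 27 * productConst s ^ 2 * (R * ‖u - v‖ * R) := n2.trans (by gcongr)
  have m3 : ‖k₃‖ ≤ 27 * productConst s ^ 2 * (R * R * ‖u - v‖) := n3.trans (by gcongr)
  calc ‖k₁ + k₂ + k₃‖ ≤ ‖k₁‖ + ‖k₂‖ + ‖k₃‖ := norm_add₃_le
    _ ≤ _ := add_le_add (add_le_add m1 m2) m3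
    _ = _ := by ring

theorem Hs.cubic_zero {s : ℝ} (hs : 1 ≤ s) : Hs.cubic hs (0 : Hs s) = 0 := by
  have := Hs.norm_cubic_le hs (0 : Hs s)
  rw [norm_zero, mul_zero] at this
  exact norm_le_zero_iff.1 this

theorem Hs.continuous_cubic {s : ℝ} (hs : 1 ≤ s) : Continuous (Hs.cubic hs) := by
  rw [continuous_iff_continuousAt]
  intro u
  rw [ContinuousAt, tendsto_iff_norm_sub_tendsto_zero]
  have h1 : ∀ᶠ v in 𝓝 u, ‖v‖ ≤ ‖u‖ + 1 := by
    filter_upwards [(continuous_norm.tendsto u).eventually (gt_mem_nhds (lt_add_one ‖u‖))] with v hv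
    exact hv.le
  have h2 : Tendsto (fun v => 81 * productConst s ^ 2 * (‖u‖ + 1) ^ 2 * ‖v - u‖) (𝓝 u) (𝓝 0) := by
    simpa using (tendsto_iff_norm_sub_tendsto_zero.1 (tendsto_id (α := Hs s) (x := 𝓝 u))).const_mul
      (81 * productConst s ^ 2 * (‖u‖ + 1) ^ 2)
  refine squeeze_zero' (Eventually.of_forall fun _ => norm_nonneg _) ?_ h2
  filter_upwards [h1] with v hv
  exact Hs.norm_cubic_sub_le hs hv (by linarith)

/-- The free propagator on `H^s`. -/
abbrev Hs.propagator {s : ℝ} (hs : 1 ≤ s) (t : ℝ) : Hs s →ₗᵢ[ℂ] Hs s :=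
  Hs.phaseFlow (zero_le_one.trans hs) halfLaplacianSymbol (-t)

theorem Hs.toL2_propagator {s : ℝ} (hs : 1 ≤ s) (t : ℝ) (f : Hs s) :
    (Hs.propagator hs t f).toL2 = Semirelativistic.propagator t f.toL2 :=
  Hs.toL2_phaseFlow _ _ _ _

theorem Hs.toL2_real_smul {s : ℝ} (c : ℝ) (f : Hs s) : (c • f).toL2 = c • f.toL2 := by
  rw [← L2_coe_smul, ← map_smul]
  rfl

/-- The vector field of the cubic equation in the interaction picture. -/
def cubicField {s : ℝ} (hs : 1 ≤ s) (t : ℝ) (x : Hs s) : Hs s :=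
  -Hs.propagator hs (-t) (Hs.cubic hs (Hs.propagator hs t x))

section CubicField

variable {s : ℝ} (hs : 1 ≤ s)

theorem norm_cubicField_sub_le {R : ℝ} (t : ℝ) {x y : Hs s} (hx : ‖x‖ ≤ R) (hy : ‖y‖ ≤ R) :
    ‖cubicField hs t x - cubicField hs t y‖ ≤ 81 * productConst s ^ 2 * R ^ 2 * ‖x - y‖ := by
  rw [cubicField, cubicField, neg_sub_neg, ← map_sub, LinearIsometry.norm_map, norm_sub_rev]
  refine (Hs.norm_cubic_sub_le hs (R := R) ?_ ?_).trans_eq ?_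
  · rwa [LinearIsometry.norm_map]
  · rwa [LinearIsometry.norm_map]
  · rw [← map_sub, LinearIsometry.norm_map]

theorem continuous_cubicField (x : Hs s) : Continuous fun t => cubicField hs t x := by
  have hc := Hs.continuous_phaseFlow (zero_le_one.trans hs) halfLaplacianSymbol
  refine Continuous.neg (continuous_iff_continuousAt.2 fun t => ?_)
  have h1 : Continuous fun t => Hs.cubic hs (Hs.propagator hs t x) :=
    (Hs.continuous_cubic hs).comp ((hc x).comp continuous_neg)
  exact tendsto_isometry_family _ hc (continuous_neg.comp continuous_neg).continuousAt
    h1.continuousAt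

theorem cubicField_zero (t : ℝ) : cubicField hs t 0 = 0 := by
  rw [cubicField, map_zero, Hs.cubic_zero, map_zero, neg_zero]

theorem toL2_cubicField (hp : (1 : ℝ) < 3) (t : ℝ) {x : Hs s} {R : ℝ} (hx : ‖x‖ ≤ R) :
    (cubicField hs t x).toL2 =
      -propagator (-t) (cutNLLp hp (cutHeight_nonneg R) (propagator t x.toL2)) := by
  rw [cubicField, map_neg, Hs.toL2_propagator,
    Hs.toL2_cubic hs _ (cutHeight_nonneg R) hp
      (Hs.ae_norm_le_cutHeight hs _ (by rwa [LinearIsometry.norm_map])), Hs.toL2_propagator]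

/-- The growth rate depends only on `r`, a bound on quantities that dissipation keeps under control,
so the field is at most linear in the `H^s` norm along solutions. -/
theorem norm_cubicField_le (t : ℝ) {x : Hs s} {r : ℝ} (h2 : ‖x.toL2‖ ≤ r)
    (h1 : TranslationBound x.toL2 r) :
    ‖cubicField hs t x‖ ≤ 3 * productConst s ^ 2 * cutHeight r ^ 2 * ‖x‖ := by
  have hr : 0 ≤ r := (norm_nonneg _).trans h2
  rw [cubicField, norm_neg, LinearIsometry.norm_map]
  refine (Hs.norm_cubic_le hs _).trans ?_
  rw [LinearIsometry.norm_map, Hs.toL2_propagator]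
  have h3 := ((h1.phaseFlow halfLaplacianSymbol (-t)).integral_fourier_le hr one_pos one_pos).2
  have h4 : fourierL1 (propagator t x.toL2) ≤ cutHeight r := by
    refine h3.trans ?_
    rw [LinearIsometry.norm_map, cutHeight]
    have : ‖x.toL2‖ ^ 2 ≤ r ^ 2 := by gcongr
    linarith
  have := fourierL1_nonneg (propagator t x.toL2)
  gcongr

/-- The a priori bound in `H^s` on `[0, T]` for data in the ball of radius `r`. -/
def sobolevBound (s T r : ℝ) : ℝ :=
  r * Real.exp (3 * productConst s ^ 2 * cutHeight r ^ 2 * T)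

theorem sobolevBound_mono {T : ℝ} (hT : 0 ≤ T) {r r' : ℝ} (hr : 0 ≤ r) (h : r ≤ r') :
    sobolevBound s T r ≤ sobolevBound s T r' := by
  have h1 : cutHeight r ≤ cutHeight r' := by
    unfold cutHeight
    gcongr
  have h2 := cutHeight_nonneg r
  have h3 : 0 ≤ r' := hr.trans h
  unfold sobolevBound
  gcongr

theorem TranslationBound.smul {f : L2} {R c : ℝ} (hf : TranslationBound f R) (hc0 : 0 ≤ c)
    (hc1 : c ≤ 1) : TranslationBound (c • f) R := fun h => by
  rw [isometry_map_real_smul, ← smul_sub, norm_smul, Real.norm_of_nonneg hc0]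
  exact (mul_le_of_le_one_left (norm_nonneg _) hc1).trans (hf h)

/-- Global solutions of the cubic equation in the interaction picture. -/
theorem exists_cubic_integralCurve {T : ℝ} (hT : 0 ≤ T) (u₀ : Hs s) :
    ∃ w : ℝ → Hs s, w 0 = u₀ ∧
      (∀ t ∈ Set.Icc 0 T, HasDerivWithinAt w (cubicField hs t (w t)) (Set.Icc 0 T) t) ∧
      ∀ t ∈ Set.Icc 0 T, ‖w t‖ ≤ sobolevBound s T ‖u₀‖ := by
  have hs0 : 0 ≤ s := by linarith
  have hp : (1 : ℝ) < 3 := by norm_num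
  have := Hs.completeSpace hs0
  set r := ‖u₀‖
  have hr : 0 ≤ r := norm_nonneg _
  -- The truncation radius is the a priori bound itself; `hbound` shows that the truncated curve
  -- never exceeds it.
  set R := sobolevBound s T r
  have hR : 0 ≤ R := by
    simp only [R, sobolevBound]
    positivity
  obtain ⟨w, hw0, hw⟩ := exists_truncated_integralCurve hT hR (cubicField hs)
    (K := (81 * productConst s ^ 2 * R ^ 2).toNNReal)
    (fun t x y hx hy => by
      rw [Real.coe_toNNReal _ (by positivity)]
      exact norm_cubicField_sub_le hs t hx hy)
    (continuous_cubicField hs) (cubicField_zero hs) u₀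
  set θ : ℝ → ℝ := fun t => radialFactor R (w t)
  have hθ : ∀ t ∈ Set.Icc 0 T, 0 ≤ θ t := fun t _ => radialFactor_nonneg hR _
  -- Truncation in `H^s` multiplies by a nonnegative scalar depending only on time, so in `L²` the
  -- curve remains an interaction curve. The `L²` and translation bounds thus hold before the `H^s`
  -- bound is known.
  have hcurve : IsInteractionCurve hp (cutHeight_nonneg R) T θ fun t => (w t).toL2 := by
    intro t ht
    have h1 := (Hs.toL2CLM hs0).hasFDerivAt.comp_hasDerivWithinAt t (hw t ht)
    rw [Hs.toL2CLM_apply, toL2_cubicField hs hp t (norm_radialRetraction_le hR _),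
      radialRetraction, Hs.toL2_real_smul, isometry_map_real_smul] at h1
    exact h1
  have hL2 : ∀ t ∈ Set.Icc 0 T, ‖(w t).toL2‖ ≤ r := fun t ht => by
    refine (hcurve.norm_le hθ ht).trans ?_
    simp only [hw0]
    exact u₀.norm_toL2_le hs0
  have hTB : ∀ t ∈ Set.Icc 0 T, TranslationBound (w t).toL2 r := fun t ht =>
    hcurve.translationBound hθ (by simp only [hw0]; exact u₀.translationBound hs) ht
  have hbound : ∀ t ∈ Set.Icc 0 T, ‖w t‖ ≤ R := by
    intro t ht
    have hC : 0 ≤ 3 * productConst s ^ 2 * cutHeight r ^ 2 := by positivity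
    have h1 := norm_le_mul_exp_of_norm_deriv_le hC le_rfl hr hw (by rw [hw0]) (fun τ hτ => ?_) ht
    · rwa [zero_mul, add_zero] at h1
    rw [add_zero]
    have h2 : (radialRetraction R (w τ)).toL2 = θ τ • (w τ).toL2 := Hs.toL2_real_smul _ _
    refine (norm_cubicField_le hs τ (r := r) ?_ ?_).trans ?_
    · rw [h2, norm_smul, Real.norm_of_nonneg (hθ τ hτ)]
      exact (mul_le_of_le_one_left (norm_nonneg _) (radialFactor_le_one _ _)).trans (hL2 τ hτ)
    · rw [h2]
      exact (hTB τ hτ).smul (hθ τ hτ) (radialFactor_le_one _ _)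
    · exact mul_le_mul_of_nonneg_left (norm_radialRetraction_le_norm hR _) hC
  refine ⟨w, hw0, fun t ht => ?_, hbound⟩
  have h1 := hw t ht
  rwa [radialRetraction_of_norm_le (hbound t ht)] at h1

/-- The solution of the cubic equation is the free evolution of an integral curve in `H^s`. -/
theorem exists_isSolution_cubic {T : ℝ} (hT : 0 ≤ T) (u₀ : Hs s) :
    ∃ u : C(Set.Icc 0 T, Hs s), IsSolution 3 hT u₀ u ∧ ∃ w : ℝ → Hs s, w 0 = u₀ ∧
      (∀ t ∈ Set.Icc 0 T, HasDerivWithinAt w (cubicField hs t (w t)) (Set.Icc 0 T) t) ∧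
      (∀ t ∈ Set.Icc 0 T, ‖w t‖ ≤ sobolevBound s T ‖u₀‖) ∧
      ∀ t : Set.Icc 0 T, u t = Hs.propagator hs t (w t) := by
  have hs0 : 0 ≤ s := by linarith
  have hp : (1 : ℝ) < 3 := by norm_num
  obtain ⟨w, hw0, hw, hb⟩ := exists_cubic_integralCurve hs hT u₀
  have hwc : Continuous fun t : Set.Icc 0 T => w t :=
    continuousOn_iff_continuous_domRestrict.1 fun t ht => (hw t ht).continuousWithinAt
  set u : C(Set.Icc 0 T, Hs s) := ⟨fun t => Hs.propagator hs t (w t), by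
    refine continuous_iff_continuousAt.2 fun t => ?_
    exact tendsto_isometry_family _ (Hs.continuous_phaseFlow hs0 halfLaplacianSymbol)
      continuous_subtype_val.neg.continuousAt hwc.continuousAt⟩
  refine ⟨u, ?_, w, hw0, hw, hb, fun t => rfl⟩
  refine isSolution_of_isInteractionCurve (w := fun t => (w t).toL2) (hp := hp)
    (hM := cutHeight_nonneg (sobolevBound s T ‖u₀‖)) hs (fun t ht => ?_)
    (fun t => Hs.toL2_propagator hs t (w t)) (by simp only [hw0]) fun t => ?_
  · have h1 := (Hs.toL2CLM hs0).hasFDerivAt.comp_hasDerivWithinAt t (hw t ht)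
    rw [Hs.toL2CLM_apply, toL2_cubicField hs hp t (hb t ht)] at h1
    simpa only [one_smul] using! h1
  · refine (u t).ae_norm_le_cutHeight hs ?_
    change ‖Hs.propagator hs t (w t)‖ ≤ _
    rw [LinearIsometry.norm_map]
    exact hb t t.2

end CubicField

/-- Uniqueness identifies the given solutions with the constructed ones, which obey the a priori
bound. On that ball the field is Lipschitz, and Gronwall in `H^s` gives Lipschitz dependence on the
data. -/
theorem exists_delta_cubic {s : ℝ} (hs : 1 ≤ s) {T : ℝ} (hT : 0 ≤ T) {R : ℝ} {ε : ℝ} (hε : 0 < ε) :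
    ∃ δ > 0, ∀ (u₀ v₀ : Hs s) (u v : C(Set.Icc 0 T, Hs s)), IsSolution 3 hT u₀ u →
      IsSolution 3 hT v₀ v → ‖u₀‖ ≤ R → ‖v₀‖ ≤ R → ‖v₀ - u₀‖ ≤ δ → ‖v - u‖ ≤ ε := by
  have hp : (1 : ℝ) < 3 := by norm_num
  set K : ℝ := 81 * productConst s ^ 2 * sobolevBound s T R ^ 2
  have hK : 0 ≤ K := by positivity
  have hE := Real.exp_pos (K * T)
  refine ⟨ε / Real.exp (K * T), by positivity, fun u₀ v₀ u v hu hv hu₀ hv₀ hδ => ?_⟩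
  obtain ⟨u', hu', w, hw0, hw, hwb, huw⟩ := exists_isSolution_cubic hs hT u₀
  obtain ⟨v', hv', z, hz0, hz, hzb, hvz⟩ := exists_isSolution_cubic hs hT v₀
  rw [IsSolution.eq hp hs hu hu', IsSolution.eq hp hs hv hv', ContinuousMap.norm_le _ hε.le]
  intro t
  rw [ContinuousMap.sub_apply, huw, hvz, ← map_sub, LinearIsometry.norm_map]
  have h1 := norm_le_mul_exp_of_norm_deriv_le (K := K) (w := fun t => z t - w t) hK le_rfl
    (norm_nonneg (v₀ - u₀)) (fun τ hτ => (hz τ hτ).sub (hw τ hτ)) (by simp only [hw0, hz0]; rfl)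
    (fun τ hτ => ?_) t.2
  · refine h1.trans ?_
    rw [zero_mul, add_zero]
    calc ‖v₀ - u₀‖ * Real.exp (K * T) ≤ ε / Real.exp (K * T) * Real.exp (K * T) := by gcongr
      _ = ε := div_mul_cancel₀ _ hE.ne'
  · rw [add_zero]
    exact norm_cubicField_sub_le hs τ
      ((hzb τ hτ).trans (sobolevBound_mono hT (norm_nonneg _) hv₀))
      ((hwb τ hτ).trans (sobolevBound_mono hT (norm_nonneg _) hu₀))

theorem globallyWellPosed_cubic {s : ℝ} (hs : 1 ≤ s) : GloballyWellPosed 3 s := fun _ hT =>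
  wellPosedOn_of_continuous_dependence (by norm_num) hs hT.le
    (fun u₀ => (exists_isSolution_cubic hs hT.le u₀).imp fun _ h => h.1)
    fun _ _ _ hε => exists_delta_cubic hs hT.le hε

end Semirelativistic

end

theorem proposition1p1 :
    (∀ p : ℝ, 1 < p → Semirelativistic.GloballyWellPosed p 1) ∧
    (∀ s : ℝ, 1 < s → s ≤ 2 → Semirelativistic.GloballyWellPosed 3 s) := by
  exact ⟨fun p hp => Semirelativistic.globallyWellPosed_H1 hp,
    fun s hs _ => Semirelativistic.globallyWellPosed_cubic hs.le⟩
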